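/- Let $\mathcal X,\mathcal Y$ be finite sets, $P$ a probability distribution on $\mathcal X$, and $d:\mathcal X\times\mathcal Y\to[0,\infty)$ a distortion measure such that for every $x$ there is a $y$ with $d(x,y)=0$. Logarithms are natural, and exponents may take the value $+\infty$ ($-\log 0=+\infty$). For a joint distribution $q$ on $\mathcal X\times\mathcal Y$ let $q_X,q_Y,q_{X|Y},q_{Y|X}$ be its marginals and conditionals, $I(q_X,q_{Y|X})$ its mutual information, and $D(q_X\|P)$ the Kullback–Leibler divergence. For $R,\Delta,\mu\ge 0$ and $0\le\lambda\le1$ define $$G(R,\Delta|P)=\min_{q:\,\mathrm E_q[d(X,Y)]\le\Delta}\{\max(0,\,I(q_X,q_{Y|X})-R)+D(q_X\|P)\},$$ $$G^{(\mu,\lambda)}(R,\Delta|P)=\min_{q}\{\lambda(I(q_X,q_{Y|X})-R)+D(q_X\|P)-\mu(\Delta-\mathrm E_q[d(X,Y)])\}.$$ A $k$-length code is a pair of maps $\varphi:\mathcal X^k\to\mathcal M$, $\psi:\mathcal M\to\mathcal Y^k$ with $\mathcal M$ finite. Let $G^{(k)}(R,\Delta|P)$ be the minimum, over all such codes with $\frac1k\log|\mathcal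 M|\le R$, of $$-\tfrac1k\log\Pr\Big\{\tfrac1k\sum_{i=1}^k d\big(X_i,\psi(\varphi(X^k))_i\big)\le\Delta\Big\},$$ where $X^k=(X_1,\dots,X_k)$ is i.i.d. with law $P$, and let $G^*(R,\Delta|P)=\lim_{k\to\infty}G^{(k)}(R,\Delta|P)$. Then for all $R\ge0$ and $\Delta\ge0$: (1) For all $0\le\lambda\le1$ and $\mu\ge0$, with the minimum over joint distributions $p$ on $\mathcal X\times\mathcal Y$ attained, $$G^{(\mu,\lambda)}(R,\Delta|P)=-\lambda R-\mu\Delta+\min_{p}\left\{-\log \mathrm E_p\!\left[\frac{P(X)e^{-\mu d(X,Y)}}{p_X(X)^{1-\lambda}\,p_{X|Y}(X|Y)^{\lambda}}\right]\right\}.$$ (2) The limit $G^*(R,\Delta|P)$ exists and $$G^*(R,\Delta|P)=G(R,\Delta|P)=\max_{0\le\lambda\le1}\,\sup_{\mu\ge0}\,G^{(\mu,\lambda)}(R,\Delta|P)=\max_{0\le\lambda\le1}\,\sup_{\mu\ge0}\,\min_{p}\left\{-\lambda R-\mu\Delta-\log \mathrm E_p\!\left[\frac{P(X)e^{-\mu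 d(X,Y)}}{p_X(X)^{1-\lambda}\,p_{X|Y}(X|Y)^{\lambda}}\right]\right\}.$$ If $\Delta>0$, then for every $\lambda\in[0,1]$ the supremum over $\mu\ge0$ is a maximum. -/

import Mathlib

open Filter Topology

noncomputable section

namespace LossyCoding

variable {X Y : Type*} [Fintype X] [Fintype Y]

/-! Probability distributions on a finite set `A` are the elements of `stdSimplex ℝ A`.
Logarithms are natural. Quantities that may be `+∞` take values in `EReal`. -/

/-- Marginal `q_X` of a joint distribution. -/
def margX (q : X × Y → ℝ) (x : X) : ℝ := ∑ y, q (x, y)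

/-- Marginal `q_Y` of a joint distribution. -/
def margY (q : X × Y → ℝ) (y : Y) : ℝ := ∑ x, q (x, y)

/-- Conditional probability `q_{X|Y}(x|y)`; only used where `q (x, y) > 0`. -/
def condXY (q : X × Y → ℝ) (x : X) (y : Y) : ℝ := q (x, y) / margY q y

/-- Expected distortion `E_q[d(X,Y)]`. -/
def expDist (d : X → Y → ℝ) (q : X × Y → ℝ) : ℝ := ∑ x, ∑ y, q (x, y) * d x y

/-- Mutual information `I(q_X, q_{Y|X})`, with `0 log 0 = 0`. -/
def mutualInfo (q : X × Y → ℝ) : ℝ :=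
  ∑ x, ∑ y, q (x, y) * Real.log (q (x, y) / (margX q x * margY q y))

open Classical in
/-- Divergence `D(q || P)`, equal to `+∞` when `q` is not absolutely continuous w.r.t. `P`. -/
def relEnt (q P : X → ℝ) : EReal :=
  if ∀ x, P x = 0 → q x = 0 then ((∑ x, q x * Real.log (q x / P x) : ℝ) : EReal) else ⊤

/-- Extended logarithm of a nonnegative real number, `log 0 = -∞`. -/
def elog (t : ℝ) : EReal := ENNReal.log (ENNReal.ofReal t)

/-- Average distortion `d(x^k, y^k) = (1/k) ∑ d(x_i, y_i)`. -/
def avgDist (d : X → Y → ℝ) {k : ℕ} (x : Fin k → X) (y : Fin k → Y) : ℝ :=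
  1 / (k : ℝ) * ∑ i, d (x i) (y i)

open Classical in
/-- Probability of correct decoding `Pr{d(X^k, ψ(φ(X^k))) ≤ Δ}` of a code `(φ, ψ)`,
for `X^k` i.i.d. with law `P`. -/
def probCorrect (P : X → ℝ) (d : X → Y → ℝ) (Δ : ℝ) {k M : ℕ}
    (φ : (Fin k → X) → Fin M) (ψ : Fin M → (Fin k → Y)) : ℝ :=
  ∑ x : Fin k → X, if avgDist d x (ψ (φ x)) ≤ Δ then ∏ i, P (x i) else 0

/-- `G^{(k)}(R, Δ | P)`: the least exponent `-(1/k) log P_c` over all codes of block length `k`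
and rate `(1/k) log |M_k| ≤ R`. -/
def blockExponent (P : X → ℝ) (d : X → Y → ℝ) (R Δ : ℝ) (k : ℕ) : EReal :=
  ⨅ (M : ℕ) (_ : 1 / (k : ℝ) * Real.log M ≤ R)
    (φ : (Fin k → X) → Fin M) (ψ : Fin M → (Fin k → Y)),
    ((-(1 / (k : ℝ)) : ℝ) : EReal) * elog (probCorrect P d Δ φ ψ)

/-- `G(R, Δ | P) = min { |I(q_X, q_{Y|X}) - R|⁺ + D(q_X || P) }` over the joint distributions `q`
with `E_q[d(X,Y)] ≤ Δ`. -/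
def expG (P : X → ℝ) (d : X → Y → ℝ) (R Δ : ℝ) : EReal :=
  ⨅ (q : X × Y → ℝ) (_ : q ∈ stdSimplex ℝ (X × Y)) (_ : expDist d q ≤ Δ),
    ((max 0 (mutualInfo q - R) : ℝ) : EReal) + relEnt (margX q) P

/-- `G^{(μ,λ)}(R, Δ | P) =
min { λ (I(q_X, q_{Y|X}) - R) + D(q_X || P) - μ (Δ - E_q[d(X,Y)]) }` over all joint
distributions `q`. -/
def expGParam (P : X → ℝ) (d : X → Y → ℝ) (R Δ mu lam : ℝ) : EReal :=
  ⨅ (q : X × Y → ℝ) (_ : q ∈ stdSimplex ℝ (X × Y)),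
    ((lam * (mutualInfo q - R) - mu * (Δ - expDist d q) : ℝ) : EReal) + relEnt (margX q) P

/-- The expectation
`E_p[ P(X) exp(-μ d(X,Y)) / (p_X(X)^{1-λ} p_{X|Y}(X|Y)^λ) ]`. -/
def normFactor (P : X → ℝ) (d : X → Y → ℝ) (mu lam : ℝ) (p : X × Y → ℝ) : ℝ :=
  ∑ x, ∑ y, p (x, y) *
    (P x * Real.exp (-(mu * d x y)) / (margX p x ^ (1 - lam) * condXY p x y ^ lam))

end LossyCoding

end

open LossyCoding

set_option linter.unusedSectionVars false

namespace LossyCoding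

variable {X Y : Type*} [Fintype X] [Fintype Y]

/-! The argument is a sandwich between a converse valid at every block length and a random coding
bound, with convex duality identifying the two ends.

Mutual information is not convex in the joint law, but `I + D(q_X‖P) = ∑ q log (q_{X|Y} / P)` is,
and so is `D`. Since `max(0, I − R) + D = max(D, I + D − R)`, `G` minimises the maximum of two
convex continuous functions over a compact convex set (`acDist` cut by the distortion constraint).
Separation in the plane (`exists_convex_comb_ge`) replaces the maximum by a combination with weight
`λ`; a Lagrange multiplier (`exists_multiplier`) then removes the constraint up to `ε`. This is
`exists_dual`.

For fixed `(μ, λ)` with `λ > 0`, put `e = exp(−μ d/λ)` and let `Q` maximise `∑ P(x) S(x)^λ`, where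
`S(x) = ∑ Q(y) e(x,y)`; let `F` be the maximum. The first-order conditions at `Q` do three things
(`exists_saddle`). With weighted AM–GM they bound `normFactor` by `F` for every `p`. By
complementary slackness they yield a tilted law `p` on whose support the ratio inside `normFactor`
is constantly `F`. Applied letter by letter, they bound the success probability of any code by
`exp(μkΔ) M^λ F^k`. The Lagrangian is the expectation of minus the logarithm of that ratio, so
Jensen's inequality makes `−log F` the common minimum of the Lagrangian (up to `−λR − μΔ`) and of
`−log normFactor`. Hence every `G^{(μ,λ)}` lies below every block exponent, and by duality so does
`G`.

Conversely, random codewords drawn from `q_Y^k`, analysed by a change of measure on a set of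
`q^k`-probability at least one half, reach the exponent `max(0, I − R) + D` asymptotically
(`eventually_exists_code`). -/

/-- The real number `∑ q_X log (q_X / P)`, equal to `D(q_X || P)` when `q_X ≪ P`. -/
noncomputable def divX (P : X → ℝ) (q : X × Y → ℝ) : ℝ :=
  ∑ x, margX q x * Real.log (margX q x / P x)

/-- Joint distributions whose first marginal is absolutely continuous with respect to `P`. -/
def acDist (Y : Type*) [Fintype Y] (P : X → ℝ) : Set (X × Y → ℝ) :=
  {q | q ∈ stdSimplex ℝ (X × Y) ∧ ∀ x, P x = 0 → margX q x = 0}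

/-! ### Marginals and the compact convex domain `acDist` -/

lemma margX_nonneg {q : X × Y → ℝ} (hq : ∀ z, 0 ≤ q z) (x : X) : 0 ≤ margX q x :=
  Finset.sum_nonneg fun _ _ => hq _

lemma margY_nonneg {q : X × Y → ℝ} (hq : ∀ z, 0 ≤ q z) (y : Y) : 0 ≤ margY q y :=
  Finset.sum_nonneg fun _ _ => hq _

lemma le_margX {q : X × Y → ℝ} (hq : ∀ z, 0 ≤ q z) (x : X) (y : Y) : q (x, y) ≤ margX q x :=
  Finset.single_le_sum (f := fun y => q (x, y)) (fun _ _ => hq _) (Finset.mem_univ y)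

lemma le_margY {q : X × Y → ℝ} (hq : ∀ z, 0 ≤ q z) (x : X) (y : Y) : q (x, y) ≤ margY q y :=
  Finset.single_le_sum (f := fun x => q (x, y)) (fun _ _ => hq _) (Finset.mem_univ x)

lemma eq_zero_of_margX {q : X × Y → ℝ} (hq : ∀ z, 0 ≤ q z) {x : X} (h : margX q x = 0) (y : Y) :
    q (x, y) = 0 :=
  le_antisymm (h ▸ le_margX hq x y) (hq _)

lemma eq_zero_of_margY {q : X × Y → ℝ} (hq : ∀ z, 0 ≤ q z) {y : Y} (h : margY q y = 0) (x : X) :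
    q (x, y) = 0 :=
  le_antisymm (h ▸ le_margY hq x y) (hq _)

lemma sum_sum_eq_one {q : X × Y → ℝ} (hq : q ∈ stdSimplex ℝ (X × Y)) :
    ∑ x, ∑ y, q (x, y) = 1 := by
  rw [← hq.2, Fintype.sum_prod_type]

lemma margY_mem {q : X × Y → ℝ} (hq : q ∈ stdSimplex ℝ (X × Y)) : margY q ∈ stdSimplex ℝ Y :=
  ⟨margY_nonneg hq.1, by rw [← sum_sum_eq_one hq, Finset.sum_comm]; rfl⟩

lemma margX_comb (a b : ℝ) (p q : X × Y → ℝ) (x : X) :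
    margX (a • p + b • q) x = a * margX p x + b * margX q x := by
  simp [margX, Finset.sum_add_distrib, Finset.mul_sum]

lemma margY_comb (a b : ℝ) (p q : X × Y → ℝ) (y : Y) :
    margY (a • p + b • q) y = a * margY p y + b * margY q y := by
  simp [margY, Finset.sum_add_distrib, Finset.mul_sum]

lemma expDist_comb (d : X → Y → ℝ) (a b : ℝ) (p q : X × Y → ℝ) :
    expDist d (a • p + b • q) = a * expDist d p + b * expDist d q := by
  simp [expDist, Finset.sum_add_distrib, Finset.mul_sum, add_mul, mul_assoc]

lemma expDist_nonneg {d : X → Y → ℝ} (hd : ∀ x y, 0 ≤ d x y) {q : X × Y → ℝ}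
    (hq : ∀ z, 0 ≤ q z) : 0 ≤ expDist d q :=
  Finset.sum_nonneg fun _ _ => Finset.sum_nonneg fun _ _ => mul_nonneg (hq _) (hd _ _)

@[fun_prop]
lemma continuous_margX (x : X) : Continuous fun q : X × Y → ℝ => margX q x := by
  unfold margX; fun_prop

@[fun_prop]
lemma continuous_margY (y : Y) : Continuous fun q : X × Y → ℝ => margY q y := by
  unfold margY; fun_prop

@[fun_prop]
lemma continuous_expDist (d : X → Y → ℝ) : Continuous (expDist d) := by
  unfold expDist; fun_prop

lemma convex_acDist (P : X → ℝ) : Convex ℝ (acDist Y P) := by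
  intro p hp q hq a b ha hb hab
  refine ⟨convex_stdSimplex ℝ _ hp.1 hq.1 ha hb hab, fun x hx => ?_⟩
  rw [margX_comb, hp.2 x hx, hq.2 x hx]; simp

lemma isCompact_acDist (P : X → ℝ) : IsCompact (acDist Y P) := by
  refine (isCompact_stdSimplex ℝ (X × Y)).inter_right (t := {q | ∀ x, P x = 0 → margX q x = 0}) ?_
  simp only [Set.ofPred_forall]
  exact isClosed_iInter fun x => isClosed_iInter fun _ =>
    isClosed_eq (continuous_margX x) continuous_const

lemma eq_zero_of_acDist {P : X → ℝ} {q : X × Y → ℝ} (hq : q ∈ acDist Y P) {x : X}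
    (hx : P x = 0) (y : Y) : q (x, y) = 0 :=
  eq_zero_of_margX hq.1.1 (hq.2 x hx) y

/-! ### Convexity and continuity of `D` and `I + D` -/

/-- The perspective function `a log (a / b)` is jointly convex. -/
lemma mul_log_div_convex {a₁ b₁ a₂ b₂ s t : ℝ} (ha₁ : 0 ≤ a₁) (hb₁ : 0 ≤ b₁) (ha₂ : 0 ≤ a₂)
    (hb₂ : 0 ≤ b₂) (h₁ : b₁ = 0 → a₁ = 0) (h₂ : b₂ = 0 → a₂ = 0) (hs : 0 ≤ s) (ht : 0 ≤ t) :
    (s * a₁ + t * a₂) * Real.log ((s * a₁ + t * a₂) / (s * b₁ + t * b₂)) ≤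
      s * (a₁ * Real.log (a₁ / b₁)) + t * (a₂ * Real.log (a₂ / b₂)) := by
  -- A lower bound linear in `(a, b)`, tight at `c = a / b`. Using the single slope `c = A / B` of
  -- the combined point at both endpoints gives convexity.
  have key : ∀ {a b c : ℝ}, 0 ≤ a → 0 ≤ b → (b = 0 → a = 0) → 0 < c →
      a * (1 + Real.log c) - b * c ≤ a * Real.log (a / b) := by
    intro a b c ha hb h hc
    rcases ha.eq_or_lt with rfl | ha
    · simp; positivity
    have hb : 0 < b := lt_of_le_of_ne hb fun e => ha.ne' (h e.symm)
    have := Real.log_le_sub_one_of_pos (x := b * c / a) (by positivity)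
    rw [Real.log_div (by positivity) ha.ne', Real.log_mul hb.ne' hc.ne'] at this
    rw [Real.log_div ha.ne' hb.ne']
    have h3 := mul_le_mul_of_nonneg_left this ha.le
    have h4 : a * (b * c / a - 1) = b * c - a := by field_simp
    rw [h4] at h3
    linarith
  set A := s * a₁ + t * a₂ with hA
  set B := s * b₁ + t * b₂ with hB
  have hA0 : 0 ≤ A := by positivity
  rcases hA0.eq_or_lt with h0 | hApos
  · have e1 : s * a₁ = 0 := by nlinarith [mul_nonneg hs ha₁, mul_nonneg ht ha₂]
    have e2 : t * a₂ = 0 := by nlinarith [mul_nonneg hs ha₁, mul_nonneg ht ha₂]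
    rw [← h0, ← mul_assoc, ← mul_assoc, e1, e2]; simp
  have hBpos : 0 < B := by
    have hB0 : 0 ≤ B := by positivity
    refine lt_of_le_of_ne hB0 fun e => hApos.ne' ?_
    have e1 : s * b₁ = 0 := by nlinarith [mul_nonneg hs hb₁, mul_nonneg ht hb₂]
    have e2 : t * b₂ = 0 := by nlinarith [mul_nonneg hs hb₁, mul_nonneg ht hb₂]
    rcases mul_eq_zero.1 e1 with h | h <;> rcases mul_eq_zero.1 e2 with h' | h' <;>
      simp [hA, h, h', h₁, h₂]
  have hc : 0 < A / B := by positivity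
  have k1 := mul_le_mul_of_nonneg_left (key ha₁ hb₁ h₁ hc) hs
  have k2 := mul_le_mul_of_nonneg_left (key ha₂ hb₂ h₂ hc) ht
  have e : B * (A / B) = A := by field_simp
  have e' : s * (a₁ * (1 + Real.log (A / B)) - b₁ * (A / B)) +
      t * (a₂ * (1 + Real.log (A / B)) - b₂ * (A / B)) =
      A * Real.log (A / B) + (A - B * (A / B)) := by
    rw [hA, hB]; ring
  rw [e] at e'
  linarith

lemma divX_eq {P : X → ℝ} {q : X × Y → ℝ} (hq : q ∈ acDist Y P) :
    divX P q = ∑ x, (margX q x * Real.log (margX q x) - margX q x * Real.log (P x)) := by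
  refine Finset.sum_congr rfl fun x _ => ?_
  rcases eq_or_ne (margX q x) 0 with h | h
  · simp [h]
  · rw [Real.log_div h fun e => h (hq.2 x e)]; ring

lemma divX_eq_sum (P : X → ℝ) (q : X × Y → ℝ) :
    divX P q = ∑ x, ∑ y, q (x, y) * Real.log (margX q x / P x) := by
  refine Finset.sum_congr rfl fun x _ => ?_
  rw [← Finset.sum_mul]; rfl

/-- The logarithms of `q_X` cancel, leaving a sum of perspective terms in `(q, q_Y)`; this is what
makes the sum convex although `I` alone is not. -/
lemma mutualInfo_add_divX {P : X → ℝ} {q : X × Y → ℝ} (hq : q ∈ acDist Y P) :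
    mutualInfo q + divX P q =
      ∑ x, ∑ y, (q (x, y) * Real.log (q (x, y) / margY q y) - q (x, y) * Real.log (P x)) := by
  rw [divX_eq_sum, mutualInfo, ← Finset.sum_add_distrib]
  refine Finset.sum_congr rfl fun x _ => ?_
  rw [← Finset.sum_add_distrib]
  refine Finset.sum_congr rfl fun y _ => ?_
  rcases eq_or_ne (q (x, y)) 0 with h | h
  · simp [h]
  have h1 : margX q x ≠ 0 := fun e => h (eq_zero_of_margX hq.1.1 e y)
  have h2 : margY q y ≠ 0 := fun e => h (eq_zero_of_margY hq.1.1 e x)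
  have h3 : P x ≠ 0 := fun e => h1 (hq.2 x e)
  rw [Real.log_div h (mul_ne_zero h1 h2), Real.log_mul h1 h2, Real.log_div h1 h3,
    Real.log_div h h2]
  ring

/-- The quotients are split so that only `t log t` terms and linear terms remain; these are
continuous up to the boundary, where the quotients are not. -/
lemma mutualInfo_add_divX' {P : X → ℝ} {q : X × Y → ℝ} (hq : q ∈ acDist Y P) :
    mutualInfo q + divX P q =
      ∑ x, ∑ y, (q (x, y) * Real.log (q (x, y)) - q (x, y) * Real.log (P x)) -
        ∑ y, margY q y * Real.log (margY q y) := by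
  have e : ∑ y, margY q y * Real.log (margY q y) =
      ∑ x, ∑ y, q (x, y) * Real.log (margY q y) := by
    rw [Finset.sum_comm]
    exact Finset.sum_congr rfl fun y _ => by rw [← Finset.sum_mul]; rfl
  rw [mutualInfo_add_divX hq, e, ← Finset.sum_sub_distrib]
  refine Finset.sum_congr rfl fun x _ => ?_
  rw [← Finset.sum_sub_distrib]
  refine Finset.sum_congr rfl fun y _ => ?_
  rcases eq_or_ne (q (x, y)) 0 with h | h
  · simp [h]
  have h2 : margY q y ≠ 0 := fun e => h (eq_zero_of_margY hq.1.1 e x)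
  rw [Real.log_div h h2]
  ring

lemma continuousOn_divX (P : X → ℝ) : ContinuousOn (divX P) (acDist Y P) := by
  refine ContinuousOn.congr (f := fun q => ∑ x, (margX q x * Real.log (margX q x) -
    margX q x * Real.log (P x))) (Continuous.continuousOn ?_) fun q hq => divX_eq hq
  refine continuous_finsetSum _ fun x _ => ?_
  exact (Real.continuous_mul_log.comp (continuous_margX x)).sub (by fun_prop)

lemma continuousOn_mutualInfo_add_divX (P : X → ℝ) :
    ContinuousOn (fun q => mutualInfo q + divX P q) (acDist Y P) := by
  refine ContinuousOn.congr (Continuous.continuousOn ?_) fun q hq => mutualInfo_add_divX' hq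
  refine Continuous.sub ?_ ?_
  · refine continuous_finsetSum _ fun x _ => continuous_finsetSum _ fun y _ => ?_
    exact (Real.continuous_mul_log.comp (continuous_apply _)).sub (by fun_prop)
  · exact continuous_finsetSum _ fun y _ => Real.continuous_mul_log.comp (continuous_margY y)

lemma convexOn_divX {P : X → ℝ} (hP : ∀ x, 0 ≤ P x) : ConvexOn ℝ (acDist Y P) (divX P) := by
  refine ⟨convex_acDist P, fun p hp q hq a b ha hb hab => ?_⟩
  simp only [divX, smul_eq_mul, Finset.mul_sum, ← Finset.sum_add_distrib]
  refine Finset.sum_le_sum fun x _ => ?_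
  rw [margX_comb]
  have := mul_log_div_convex (margX_nonneg hp.1.1 x) (hP x) (margX_nonneg hq.1.1 x) (hP x)
    (hp.2 x) (hq.2 x) ha hb
  rwa [← add_mul, hab, one_mul] at this

lemma convexOn_mutualInfo_add_divX (P : X → ℝ) :
    ConvexOn ℝ (acDist Y P) (fun q => mutualInfo q + divX P q) := by
  refine ⟨convex_acDist P, fun p hp q hq a b ha hb hab => ?_⟩
  simp only [mutualInfo_add_divX hp, mutualInfo_add_divX hq,
    mutualInfo_add_divX (convex_acDist P hp hq ha hb hab), smul_eq_mul, Finset.mul_sum,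
    ← Finset.sum_add_distrib]
  refine Finset.sum_le_sum fun x _ => Finset.sum_le_sum fun y _ => ?_
  rw [margY_comb]
  have := mul_log_div_convex (hp.1.1 (x, y)) (margY_nonneg hp.1.1 y) (hq.1.1 (x, y))
    (margY_nonneg hq.1.1 y) (fun e => eq_zero_of_margY hp.1.1 e x)
    (fun e => eq_zero_of_margY hq.1.1 e x) ha hb
  simp only [Pi.add_apply, Pi.smul_apply, smul_eq_mul]
  linarith

lemma convexOn_expDist (d : X → Y → ℝ) {s : Set (X × Y → ℝ)} (hs : Convex ℝ s) :
    ConvexOn ℝ s (expDist d) :=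
  ⟨hs, fun p _ q _ a b _ _ _ => by rw [expDist_comb]; rfl⟩

/-! ### Separation and Lagrange duality -/

/-- Two convex functions whose maximum is at least `g` admit a convex combination
which is at least `g`. -/
lemma exists_convex_comb_ge {E : Type*} [AddCommGroup E] [Module ℝ E] {K : Set E} {f₁ f₂ : E → ℝ}
    (h₁ : ConvexOn ℝ K f₁) (h₂ : ConvexOn ℝ K f₂) (hK : K.Nonempty) {g : ℝ}
    (hg : ∀ q ∈ K, g ≤ max (f₁ q) (f₂ q)) :
    ∃ t ∈ Set.Icc (0 : ℝ) 1, ∀ q ∈ K, g ≤ (1 - t) * f₁ q + t * f₂ q := by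
  let S : Set (ℝ × ℝ) := Set.Iio g ×ˢ Set.Iio g
  -- Taking the upper closure of the image makes `T` convex and later forces both coordinates of the
  -- separating functional to be nonnegative.
  let T : Set (ℝ × ℝ) := {z | ∃ q ∈ K, f₁ q ≤ z.1 ∧ f₂ q ≤ z.2}
  have hS : Convex ℝ S := (convex_Iio g).prod (convex_Iio g)
  have hSo : IsOpen S := isOpen_Iio.prod isOpen_Iio
  have hT : Convex ℝ T := by
    rintro z ⟨p, hp, hp1, hp2⟩ w ⟨q, hq, hq1, hq2⟩ a b ha hb hab
    refine ⟨a • p + b • q, h₁.1 hp hq ha hb hab, ?_, ?_⟩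
    · refine (h₁.2 hp hq ha hb hab).trans ?_
      simp only [smul_eq_mul, Prod.fst_add, Prod.smul_fst]
      gcongr
    · refine (h₂.2 hp hq ha hb hab).trans ?_
      simp only [smul_eq_mul, Prod.snd_add, Prod.smul_snd]
      gcongr
  have hd : Disjoint S T := by
    rw [Set.disjoint_left]
    rintro z ⟨hz1, hz2⟩ ⟨q, hq, hq1, hq2⟩
    have := hg q hq
    simp only [Set.mem_Iio] at hz1 hz2
    rcases le_max_iff.1 this with h | h <;> linarith
  obtain ⟨φ, s, hφS, hφT⟩ := geometric_hahn_banach_open hS hSo hT hd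
  have hφ : ∀ z : ℝ × ℝ, φ z = z.1 * φ (1, 0) + z.2 * φ (0, 1) := by
    intro z
    have : z = z.1 • ((1 : ℝ), (0 : ℝ)) + z.2 • ((0 : ℝ), (1 : ℝ)) := by ext <;> simp
    conv_lhs => rw [this]
    rw [map_add, map_smul, map_smul]; rfl
  set u := φ (1, 0)
  set v := φ (0, 1)
  have hS' : ∀ a < g, ∀ b < g, a * u + b * v < s := fun a ha b hb => by
    have := hφS (a, b) ⟨ha, hb⟩
    rwa [hφ] at this
  have hT' : ∀ q ∈ K, ∀ a, f₁ q ≤ a → ∀ b, f₂ q ≤ b → s ≤ a * u + b * v :=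
    fun q hq a ha b hb => by
      have := hφT (a, b) ⟨q, hq, ha, hb⟩
      rwa [hφ] at this
  obtain ⟨q₀, hq₀⟩ := hK
  have hT0 := hT' q₀ hq₀ _ le_rfl _ le_rfl
  have hu : 0 ≤ u := by
    by_contra! h
    have := hT' q₀ hq₀ (f₁ q₀ + (1 + (f₁ q₀ * u + f₂ q₀ * v - s)) / (-u))
      (le_add_of_nonneg_right (div_nonneg (by linarith) (by linarith))) _ le_rfl
    have e : (1 + (f₁ q₀ * u + f₂ q₀ * v - s)) / (-u) * u =
      -(1 + (f₁ q₀ * u + f₂ q₀ * v - s)) := by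
        rw [div_neg, neg_mul, div_mul_cancel₀ _ h.ne]
    rw [add_mul, e] at this
    linarith
  have hv : 0 ≤ v := by
    by_contra! h
    have := hT' q₀ hq₀ _ le_rfl (f₂ q₀ + (1 + (f₁ q₀ * u + f₂ q₀ * v - s)) / (-v))
      (le_add_of_nonneg_right (div_nonneg (by linarith) (by linarith)))
    have e : (1 + (f₁ q₀ * u + f₂ q₀ * v - s)) / (-v) * v =
      -(1 + (f₁ q₀ * u + f₂ q₀ * v - s)) := by
        rw [div_neg, neg_mul, div_mul_cancel₀ _ h.ne]
    rw [add_mul, e] at this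
    linarith
  have huv : 0 < u + v := by
    refine lt_of_le_of_ne (add_nonneg hu hv) fun e => ?_
    have hu0 : u = 0 := by linarith
    have hv0 : v = 0 := by linarith
    have := hS' (g - 1) (by linarith) (g - 1) (by linarith)
    rw [hu0, hv0] at this hT0
    simp only [mul_zero, add_zero] at this hT0
    linarith
  have hgs : g * (u + v) ≤ s := by
    by_contra! h
    have := hS' (g - (g * (u + v) - s) / (u + v)) (sub_lt_self _ (div_pos (by linarith) huv))
      (g - (g * (u + v) - s) / (u + v)) (sub_lt_self _ (div_pos (by linarith) huv))
    rw [← mul_add, sub_mul, div_mul_cancel₀ _ huv.ne'] at this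
    linarith
  refine ⟨v / (u + v), ⟨by positivity, (div_le_one huv).2 (by linarith)⟩, fun q hq => ?_⟩
  have := hgs.trans (hT' q hq _ le_rfl _ le_rfl)
  have e : (1 - v / (u + v)) * f₁ q + v / (u + v) * f₂ q = (f₁ q * u + f₂ q * v) / (u + v) := by
    field_simp; ring
  rw [e, le_div_iff₀ huv]
  exact this

/-- Approximate Lagrange duality for one convex constraint on a compact set. -/
lemma exists_multiplier {E : Type*} [AddCommGroup E] [Module ℝ E] [TopologicalSpace E] {K : Set E}
    {f c : E → ℝ} (hK : IsCompact K) (hf : ConvexOn ℝ K f) (hc : ConvexOn ℝ K c)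
    (hfc : ContinuousOn f K) (hcc : ContinuousOn c K) (hne : ∃ q ∈ K, c q ≤ 0) {g ε : ℝ}
    (hε : 0 < ε) (hg : ∀ q ∈ K, c q ≤ 0 → g ≤ f q) :
    ∃ μ ≥ (0 : ℝ), ∀ q ∈ K, g - ε ≤ f q + μ * c q := by
  obtain ⟨q₀, hq₀, hcq₀⟩ := hne
  have hf' : ConvexOn ℝ K fun q => f q + (ε - g) := hf.add_const _
  have hcont : ContinuousOn (fun q => max (f q + (ε - g)) (c q)) K :=
    ContinuousOn.sup (hfc.add continuousOn_const) hcc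
  obtain ⟨q₁, hq₁, hmin⟩ := hK.exists_isMinOn ⟨q₀, hq₀⟩ hcont
  -- The shift by `ε` makes the maximum positive at every point of `K`, and compactness gives a
  -- positive minimum `δ`. Since `c q₀ ≤ 0 < δ`, the weight `t` cannot be `1`, so division by `1 -
  -- t` is possible without a strictly feasible point.
  have hpos : 0 < max (f q₁ + (ε - g)) (c q₁) := by
    rcases le_or_gt (c q₁) 0 with h | h
    · exact lt_max_of_lt_left (by linarith [hg q₁ hq₁ h])
    · exact lt_max_of_lt_right h
  set δ := max (f q₁ + (ε - g)) (c q₁)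
  obtain ⟨t, ⟨ht0, ht1⟩, ht⟩ := exists_convex_comb_ge hf' hc ⟨q₀, hq₀⟩ (g := δ)
    (fun q hq => hmin hq)
  have ht1' : t < 1 := by
    refine lt_of_le_of_ne ht1 fun e => ?_
    have := ht q₀ hq₀
    rw [e] at this
    linarith
  refine ⟨t / (1 - t), div_nonneg ht0 (by linarith), fun q hq => ?_⟩
  have h1 := ht q hq
  have h2 : 0 < 1 - t := by linarith
  have e : (1 - t) * (f q + (ε - g) + t / (1 - t) * c q) =
      (1 - t) * (f q + (ε - g)) + t * c q := by
    field_simp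
  have : 0 < f q + (ε - g) + t / (1 - t) * c q := by
    refine pos_of_mul_pos_right (a := 1 - t) ?_ h2.le
    rw [e]; linarith
  linarith

/-! ### Optimal output distribution and first-order conditions -/

/-- The function whose expectation is `normFactor`. -/
noncomputable def normRatio (P : X → ℝ) (d : X → Y → ℝ) (mu lam : ℝ) (p : X × Y → ℝ)
    (x : X) (y : Y) : ℝ :=
  P x * Real.exp (-(mu * d x y)) / (margX p x ^ (1 - lam) * condXY p x y ^ lam)

/-- First-order optimality conditions for the maximization of the concave function
`Q ↦ ∑ x, P x * (∑ y, Q y * e x y) ^ lam` over the simplex. -/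
lemma exists_maximizer (P : X → ℝ) [Nonempty Y] {e : X → Y → ℝ}
    (he : ∀ x y, 0 < e x y) {lam : ℝ} (hl : 0 < lam) :
    ∃ Q ∈ stdSimplex ℝ Y, (∀ x, 0 < ∑ y, Q y * e x y) ∧
      ∀ y, ∑ x, P x * (∑ y', Q y' * e x y') ^ (lam - 1) * e x y ≤
        ∑ x, P x * (∑ y', Q y' * e x y') ^ lam := by
  classical
  have hcont : Continuous fun Q : Y → ℝ => ∑ x, P x * (∑ y, Q y * e x y) ^ lam := by
    refine continuous_finsetSum _ fun x _ => continuous_const.mul ?_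
    exact Continuous.rpow_const (by fun_prop) fun _ => Or.inr hl.le
  obtain ⟨y₀⟩ := ‹Nonempty Y›
  obtain ⟨Q, hQ, hmax⟩ := (isCompact_stdSimplex ℝ Y).exists_isMaxOn
    ⟨_, single_mem_stdSimplex ℝ y₀⟩ hcont.continuousOn
  have hS : ∀ x, 0 < ∑ y, Q y * e x y := fun x => by
    have h0 : ∀ y ∈ Finset.univ, 0 ≤ Q y * e x y := fun y _ => mul_nonneg (hQ.1 y) (he x y).le
    refine lt_of_le_of_ne (Finset.sum_nonneg h0) fun h => ?_
    have hz := (Finset.sum_eq_zero_iff_of_nonneg h0).1 h.symm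
    have : ∑ y, Q y = 0 := Finset.sum_eq_zero fun y hy =>
      (mul_eq_zero.1 (hz y hy)).resolve_right (he x y).ne'
    rw [hQ.2] at this
    exact one_ne_zero this
  refine ⟨Q, hQ, hS, fun y => ?_⟩
  set S : X → ℝ := fun x => ∑ y, Q y * e x y
  replace hS : ∀ x, 0 < S x := hS
  -- Derivative along the segment from `Q` to the vertex at `y`. It exists for `lam < 1` too because
  -- `S x > 0`, and it is nonpositive from the right by maximality.
  have hder : HasDerivAt (fun t : ℝ => ∑ x, P x * (S x + t * (e x y - S x)) ^ lam)
      (∑ x, P x * ((e x y - S x) * lam * (S x) ^ (lam - 1))) 0 := by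
    refine HasDerivAt.fun_sum fun x _ => HasDerivAt.const_mul _ ?_
    have h1 : HasDerivAt (fun t : ℝ => S x + t * (e x y - S x)) (e x y - S x) 0 := by
      simpa using ((hasDerivAt_id (0 : ℝ)).mul_const (e x y - S x)).const_add (S x)
    have := h1.rpow_const (p := lam) (Or.inl (by simpa using (hS x).ne'))
    simpa using this
  have hle : ∑ x, P x * ((e x y - S x) * lam * (S x) ^ (lam - 1)) ≤ 0 := by
    refine le_of_tendsto hder.tendsto_slope_zero_right ?_
    have h01 : Set.Ioo (0 : ℝ) 1 ∈ 𝓝[>] (0 : ℝ) := Ioo_mem_nhdsGT one_pos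
    filter_upwards [h01] with t ht
    have hmem : (1 - t) • Q + t • (Pi.single y (1 : ℝ) : Y → ℝ) ∈ stdSimplex ℝ Y :=
      convex_stdSimplex ℝ Y hQ (single_mem_stdSimplex ℝ y) (by linarith [ht.2]) ht.1.le (by ring)
    have h2 : (∑ x, P x * (∑ y', ((1 - t) • Q + t • (Pi.single y (1 : ℝ) : Y → ℝ)) y' * e x y')
        ^ lam) ≤ ∑ x, P x * (S x) ^ lam := hmax hmem
    have h3 : ∀ x, ∑ y', ((1 - t) • Q + t • (Pi.single y (1 : ℝ) : Y → ℝ)) y' * e x y' =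
        S x + t * (e x y - S x) := fun x => by
      simp only [Pi.add_apply, Pi.smul_apply, smul_eq_mul, add_mul, Finset.sum_add_distrib,
        mul_assoc, ← Finset.mul_sum]
      have hs : ∑ y', (Pi.single y (1 : ℝ) : Y → ℝ) y' * e x y' = e x y := by
        simp [Pi.single_apply]
      rw [hs]
      change (1 - t) * S x + t * e x y = _
      ring
    simp only [h3] at h2
    have : (0 : ℝ) ≤ t⁻¹ := inv_nonneg.2 ht.1.le
    simp only [zero_add, smul_eq_mul, zero_mul, add_zero]
    exact mul_nonpos_of_nonneg_of_nonpos this (by linarith)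
  have e1 : ∑ x, P x * ((e x y - S x) * lam * (S x) ^ (lam - 1)) =
      lam * (∑ x, P x * (S x) ^ (lam - 1) * e x y - ∑ x, P x * (S x) ^ lam) := by
    rw [← Finset.sum_sub_distrib, Finset.mul_sum]
    refine Finset.sum_congr rfl fun x _ => ?_
    have : (S x) ^ lam = (S x) ^ (lam - 1) * S x := by
      rw [← Real.rpow_add_one (hS x).ne', sub_add_cancel]
    rw [this]; ring
  rw [e1] at hle
  nlinarith [nonpos_of_mul_nonpos_right hle hl]

/-- The tangent bound for `u ↦ u ^ lam`. -/
lemma rpow_le_tangent {u S lam : ℝ} (hu : 0 ≤ u) (hS : 0 < S) (hl : 0 ≤ lam) (hl1 : lam ≤ 1) :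
    u ^ lam ≤ (1 - lam) * S ^ lam + lam * (S ^ (lam - 1) * u) := by
  have := Real.geom_mean_le_arith_mean2_weighted (w₁ := 1 - lam) (w₂ := lam) (p₁ := S ^ lam)
    (p₂ := S ^ (lam - 1) * u) (by linarith) hl (by positivity) (by positivity) (by ring)
  refine le_trans (le_of_eq ?_) this
  rw [Real.mul_rpow (by positivity) hu, ← Real.rpow_mul hS.le, ← Real.rpow_mul hS.le, ← mul_assoc,
    ← Real.rpow_add hS, show lam * (1 - lam) + (lam - 1) * lam = 0 by ring, Real.rpow_zero, one_mul]

/-- Weighted AM–GM applied to `p / p_X * S ^ lam` and `p_Y * e * S ^ (lam - 1)`: in their weighted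
geometric mean the powers of `S` cancel, since `lam * (1 - lam) + (lam - 1) * lam = 0`. The
resulting bound can be summed with the first-order conditions. -/
lemma mul_normRatio_le {P : X → ℝ} (hP : ∀ x, 0 ≤ P x) {d e : X → Y → ℝ} {mu lam : ℝ}
    (hl : 0 < lam) (hl1 : lam ≤ 1) (he : ∀ x y, 0 < e x y)
    (hel : ∀ x y, e x y ^ lam = Real.exp (-(mu * d x y))) {p : X × Y → ℝ} (hp : ∀ z, 0 ≤ p z)
    {S : X → ℝ} (hS : ∀ x, 0 < S x) (x : X) (y : Y) :
    p (x, y) * normRatio P d mu lam p x y ≤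
      P x * ((1 - lam) * (p (x, y) / margX p x * S x ^ lam) +
        lam * (margY p y * e x y * S x ^ (lam - 1))) := by
  have hmY := margY_nonneg hp y
  have hmX := margX_nonneg hp x
  rcases (hp (x, y)).eq_or_lt with h | h
  · rw [← h]
    have := (he x y).le
    have := (hS x).le
    have := hP x
    simp only [zero_mul, zero_div]
    positivity
  have hx : 0 < margX p x := h.trans_le (le_margX hp x y)
  have hy : 0 < margY p y := h.trans_le (le_margY hp x y)
  have hSx := hS x
  have hex := he x y
  have amgm := Real.geom_mean_le_arith_mean2_weighted (w₁ := 1 - lam) (w₂ := lam)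
    (p₁ := p (x, y) / margX p x * S x ^ lam) (p₂ := margY p y * e x y * S x ^ (lam - 1))
    (by linarith) hl.le (by positivity) (by positivity) (by ring)
  refine le_trans (le_of_eq ?_) (mul_le_mul_of_nonneg_left amgm (hP x))
  have e1 : p (x, y) = p (x, y) ^ (1 - lam) * p (x, y) ^ lam := by
    rw [← Real.rpow_add h]; simp
  have e2 : (S x ^ lam) ^ (1 - lam) * (S x ^ (lam - 1)) ^ lam = 1 := by
    rw [← Real.rpow_mul hSx.le, ← Real.rpow_mul hSx.le, ← Real.rpow_add hSx,
      show lam * (1 - lam) + (lam - 1) * lam = 0 by ring, Real.rpow_zero]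
  rw [normRatio, condXY, ← hel, Real.mul_rpow (by positivity) (by positivity),
    Real.mul_rpow (by positivity) (by positivity), Real.mul_rpow hy.le hex.le,
    Real.div_rpow h.le hx.le, Real.div_rpow h.le hy.le]
  have a1 := Real.rpow_pos_of_pos hx (1 - lam)
  have a2 := Real.rpow_pos_of_pos hy lam
  have a3 := Real.rpow_pos_of_pos h lam
  have a4 := Real.rpow_pos_of_pos h (1 - lam)
  set s1 := (S x ^ lam) ^ (1 - lam)
  set s2 := (S x ^ (lam - 1)) ^ lam
  calc p (x, y) * (P x * e x y ^ lam /
        (margX p x ^ (1 - lam) * (p (x, y) ^ lam / margY p y ^ lam)))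
      = p (x, y) ^ (1 - lam) * p (x, y) ^ lam * (P x * e x y ^ lam /
        (margX p x ^ (1 - lam) * (p (x, y) ^ lam / margY p y ^ lam))) := by rw [← e1]
    _ = P x * (p (x, y) ^ (1 - lam) / margX p x ^ (1 - lam) *
          (margY p y ^ lam * e x y ^ lam)) * 1 := by field_simp
    _ = P x * (p (x, y) ^ (1 - lam) / margX p x ^ (1 - lam) * s1 *
          (margY p y ^ lam * e x y ^ lam * s2)) := by rw [← e2]; ring

/-! ### Converse bound for block codes -/

lemma avgDist_le_iff_sum {d : X → Y → ℝ} {k : ℕ} {x : Fin k → X} {y : Fin k → Y} {Δ : ℝ}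
    (h : avgDist d x y ≤ Δ) : ∑ i, d (x i) (y i) ≤ k * Δ := by
  rcases Nat.eq_zero_or_pos k with rfl | hk
  · simp
  · have hk' : (0 : ℝ) < k := by exact_mod_cast hk
    rw [avgDist, one_div, inv_mul_le_iff₀ hk'] at h
    exact h

lemma sum_prod_eq_one {A : Type*} [Fintype A] {P : A → ℝ} (hP : P ∈ stdSimplex ℝ A) (k : ℕ) :
    ∑ x : Fin k → A, ∏ i, P (x i) = 1 := by
  rw [← Fintype.sum_pow, hP.2, one_pow]

lemma probCorrect_le_one {P : X → ℝ} (hP : P ∈ stdSimplex ℝ X) (d : X → Y → ℝ) (Δ : ℝ) {k M : ℕ}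
    (φ : (Fin k → X) → Fin M) (ψ : Fin M → (Fin k → Y)) : probCorrect P d Δ φ ψ ≤ 1 := by
  rw [← sum_prod_eq_one hP k]
  refine Finset.sum_le_sum fun x _ => ?_
  split_ifs
  · exact le_rfl
  · exact Finset.prod_nonneg fun _ _ => hP.1 _

/-- Exact one-shot converse bound in terms of an optimal output distribution. -/
lemma probCorrect_le_of_tangent {P : X → ℝ} (hP : P ∈ stdSimplex ℝ X) {d e : X → Y → ℝ}
    {mu lam : ℝ} (hmu : 0 ≤ mu) (hl : 0 < lam) (hl1 : lam ≤ 1) (he : ∀ x y, 0 < e x y)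
    (hel : ∀ x y, e x y ^ lam = Real.exp (-(mu * d x y))) {S : X → ℝ} (hS : ∀ x, 0 < S x)
    (hg : ∀ y, ∑ x, P x * S x ^ (lam - 1) * e x y ≤ ∑ x, P x * S x ^ lam) (Δ : ℝ) {k M : ℕ}
    (φ : (Fin k → X) → Fin M) (ψ : Fin M → (Fin k → Y)) :
    probCorrect P d Δ φ ψ ≤
      Real.exp (mu * (k * Δ)) * (M : ℝ) ^ lam * (∑ x, P x * S x ^ lam) ^ k := by
  obtain ⟨x₀⟩ : Nonempty X := by
    by_contra h
    rw [not_nonempty_iff] at h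
    simpa using hP.2
  have hM : 0 < M := (φ fun _ => x₀).pos
  have hM' : (0 : ℝ) < M := by exact_mod_cast hM
  set F := ∑ x, P x * S x ^ lam
  let E : (Fin k → X) → Fin M → ℝ := fun x m => ∏ i, e (x i) (ψ m i)
  have hE : ∀ x m, 0 < E x m := fun x m => Finset.prod_pos fun i _ => he _ _
  let Sk : (Fin k → X) → ℝ := fun x => ∏ i, S (x i)
  have hSk : ∀ x, 0 < Sk x := fun x => Finset.prod_pos fun i _ => hS _
  have hPk : ∀ x : Fin k → X, 0 ≤ ∏ i, P (x i) := fun x => Finset.prod_nonneg fun _ _ => hP.1 _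
  -- The indicator is at most `exp(μkΔ) * E x (φ x) ^ lam`. The chosen codeword is replaced by the
  -- sum over all codewords, which no longer depends on `φ` and costs `M ^ lam` after averaging; the
  -- tangent at `Sk x` then makes the bound linear in each codeword.
  have step : ∀ x : Fin k → X, (if avgDist d x (ψ (φ x)) ≤ Δ then ∏ i, P (x i) else 0) ≤
      Real.exp (mu * (k * Δ)) * (M : ℝ) ^ lam * ((∏ i, P (x i)) *
        ((1 - lam) * Sk x ^ lam + lam * (Sk x ^ (lam - 1) * ((∑ m, E x m) / M)))) := by
    intro x
    have htan := rpow_le_tangent (u := (∑ m, E x m) / M)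
      (div_nonneg (Finset.sum_nonneg fun m _ => (hE x m).le) hM'.le) (hSk x) hl.le hl1
    have hr0 : 0 ≤ ((∑ m, E x m) / M) ^ lam :=
      Real.rpow_nonneg (div_nonneg (Finset.sum_nonneg fun m _ => (hE x m).le) hM'.le) _
    split_ifs with h
    · have h1 : E x (φ x) ^ lam ≤ (M : ℝ) ^ lam * ((∑ m, E x m) / M) ^ lam := by
        rw [← Real.mul_rpow hM'.le (div_nonneg (Finset.sum_nonneg fun m _ => (hE x m).le) hM'.le),
          mul_div_cancel₀ _ hM'.ne']
        exact Real.rpow_le_rpow (hE x _).le (Finset.single_le_sum (f := fun m => E x m)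
          (fun m _ => (hE x m).le) (Finset.mem_univ _)) hl.le
      have h2 : E x (φ x) ^ lam = Real.exp (-(mu * ∑ i, d (x i) (ψ (φ x) i))) := by
        simp only [E]
        rw [← Real.finsetProd_rpow _ _ fun i _ => (he _ _).le]
        simp only [hel]
        rw [← Real.exp_sum, Finset.sum_neg_distrib, Finset.mul_sum]
      have h3 : 1 ≤ Real.exp (mu * (k * Δ)) * E x (φ x) ^ lam := by
        rw [h2, ← Real.exp_add]
        refine Real.one_le_exp ?_
        have := mul_le_mul_of_nonneg_left (avgDist_le_iff_sum h) hmu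
        linarith
      calc ∏ i, P (x i) = (∏ i, P (x i)) * 1 := (mul_one _).symm
        _ ≤ (∏ i, P (x i)) * (Real.exp (mu * (k * Δ)) * ((M : ℝ) ^ lam *
            ((1 - lam) * Sk x ^ lam + lam * (Sk x ^ (lam - 1) * ((∑ m, E x m) / M))))) := by
          refine mul_le_mul_of_nonneg_left (h3.trans ?_) (hPk x)
          refine mul_le_mul_of_nonneg_left (h1.trans ?_) (Real.exp_pos _).le
          exact mul_le_mul_of_nonneg_left htan (by positivity)
        _ = _ := by ring
    · have := hr0.trans htan
      have := hPk x
      positivity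
  refine (Finset.sum_le_sum fun x _ => step x).trans ?_
  rw [← Finset.mul_sum]
  refine mul_le_mul_of_nonneg_left ?_ (by positivity)
  have hterm : ∀ x : Fin k → X, (∏ i, P (x i)) *
        ((1 - lam) * Sk x ^ lam + lam * (Sk x ^ (lam - 1) * ((∑ m, E x m) / M))) =
      (1 - lam) * (∏ i, P (x i) * S (x i) ^ lam) + lam * (∑ m, (1 / M : ℝ) *
        ∏ i, (P (x i) * S (x i) ^ (lam - 1) * e (x i) (ψ m i))) := by
    intro x
    simp only [Finset.prod_mul_distrib, Real.finsetProd_rpow _ _ fun i _ => (hS (x i)).le,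
      ← Finset.mul_sum]
    simp only [Sk, E]
    ring
  simp only [hterm]
  have hpow : ∑ x : Fin k → X, ∏ i, P (x i) * S (x i) ^ lam = F ^ k :=
    (Fintype.sum_pow (fun a => P a * S a ^ lam) k).symm
  rw [Finset.sum_add_distrib, ← Finset.mul_sum, ← Finset.mul_sum, hpow, Finset.sum_comm]
  -- For a fixed codeword the sum over source sequences factors over letters, and the first-order
  -- condition bounds each factor by `F`.
  have hm : ∀ m, ∑ x : Fin k → X, (1 / M : ℝ) *
      ∏ i, (P (x i) * S (x i) ^ (lam - 1) * e (x i) (ψ m i)) ≤ (1 / M : ℝ) * F ^ k := by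
    intro m
    rw [← Finset.mul_sum]
    refine mul_le_mul_of_nonneg_left ?_ (by positivity)
    rw [← Fintype.prod_sum fun i a => P a * S a ^ (lam - 1) * e a (ψ m i)]
    refine (Finset.prod_le_prod (fun i _ => Finset.sum_nonneg fun a _ => ?_)
      fun i _ => hg (ψ m i)).trans (by simp)
    exact mul_nonneg (mul_nonneg (hP.1 a) (Real.rpow_nonneg (hS a).le _)) (he _ _).le
  have hsum : ∑ m : Fin M, ∑ x : Fin k → X, (1 / M : ℝ) *
      ∏ i, (P (x i) * S (x i) ^ (lam - 1) * e (x i) (ψ m i)) ≤ F ^ k := by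
    refine (Finset.sum_le_sum fun m _ => hm m).trans (le_of_eq ?_)
    rw [Finset.sum_const, Finset.card_univ, Fintype.card_fin, nsmul_eq_mul]
    field_simp
  nlinarith [mul_le_mul_of_nonneg_left hsum hl.le]

/-! ### The common minimum of the Lagrangian and of `-log normFactor` -/

/-- After AM–GM the first part sums to at most `F` because `∑ y, p / p_X ≤ 1` (with `0 / 0 = 0`),
and the second is a `p_Y`-average of quantities that the first-order conditions bound by `F`. -/
lemma normFactor_le {P : X → ℝ} (hP : ∀ x, 0 ≤ P x) {d e : X → Y → ℝ} {mu lam : ℝ}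
    (hl : 0 < lam) (hl1 : lam ≤ 1) (he : ∀ x y, 0 < e x y)
    (hel : ∀ x y, e x y ^ lam = Real.exp (-(mu * d x y))) {S : X → ℝ} (hS : ∀ x, 0 < S x)
    (hg : ∀ y, ∑ x, P x * S x ^ (lam - 1) * e x y ≤ ∑ x, P x * S x ^ lam)
    {p : X × Y → ℝ} (hp : p ∈ stdSimplex ℝ (X × Y)) :
    normFactor P d mu lam p ≤ ∑ x, P x * S x ^ lam := by
  set F := ∑ x, P x * S x ^ lam with hF
  have h1 : normFactor P d mu lam p ≤ ∑ x, ∑ y, P x * ((1 - lam) * (p (x, y) / margX p x *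
      S x ^ lam) + lam * (margY p y * e x y * S x ^ (lam - 1))) :=
    Finset.sum_le_sum fun x _ => Finset.sum_le_sum fun y _ =>
      mul_normRatio_le hP hl hl1 he hel hp.1 hS x y
  have h2 : ∑ x, ∑ y, P x * ((1 - lam) * (p (x, y) / margX p x *
      S x ^ lam) + lam * (margY p y * e x y * S x ^ (lam - 1))) =
      (1 - lam) * ∑ x, (margX p x / margX p x) * (P x * S x ^ lam) +
      lam * ∑ y, margY p y * ∑ x, P x * S x ^ (lam - 1) * e x y := by
    simp only [Finset.mul_sum]
    rw [Finset.sum_comm (s := Finset.univ (α := Y)), ← Finset.sum_add_distrib]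
    refine Finset.sum_congr rfl fun x _ => ?_
    have : margX p x / margX p x = ∑ y, p (x, y) / margX p x := by
      rw [← Finset.sum_div]; rfl
    rw [this, Finset.sum_mul, Finset.mul_sum, ← Finset.sum_add_distrib]
    exact Finset.sum_congr rfl fun y _ => by ring
  have h3 : ∑ x, (margX p x / margX p x) * (P x * S x ^ lam) ≤ F := by
    refine Finset.sum_le_sum fun x _ => ?_
    refine mul_le_of_le_one_left (mul_nonneg (hP x) (Real.rpow_nonneg (hS x).le _)) ?_
    exact div_self_le_one _
  have h4 : ∑ y, margY p y * ∑ x, P x * S x ^ (lam - 1) * e x y ≤ F := by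
    calc _ ≤ ∑ y, margY p y * F := Finset.sum_le_sum fun y _ =>
          mul_le_mul_of_nonneg_left (hg y) (margY_nonneg hp.1 y)
      _ = F := by rw [← Finset.sum_mul, (margY_mem hp).2, one_mul]
  rw [h2] at h1
  nlinarith [mul_le_mul_of_nonneg_left h3 (sub_nonneg.2 hl1), mul_le_mul_of_nonneg_left h4 hl.le]

/-- The optimiser is the tilted law `P * S ^ (lam - 1) * Q * e / F`. Its second marginal is `Q`
itself, and with both marginals explicit the ratio collapses to the constant `F`. -/
lemma exists_normRatio_eq {P : X → ℝ} (hP : ∀ x, 0 ≤ P x) {d e : X → Y → ℝ} {mu lam : ℝ}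
    (he : ∀ x y, 0 < e x y)
    (hel : ∀ x y, e x y ^ lam = Real.exp (-(mu * d x y))) {Q : Y → ℝ} (hQ : Q ∈ stdSimplex ℝ Y)
    {S : X → ℝ} (hSQ : ∀ x, S x = ∑ y, Q y * e x y) (hS : ∀ x, 0 < S x)
    (hF : 0 < ∑ x, P x * S x ^ lam)
    (hg : ∀ y, ∑ x, P x * S x ^ (lam - 1) * e x y ≤ ∑ x, P x * S x ^ lam) :
    ∃ p ∈ acDist Y P, ∀ x y, 0 < p (x, y) →
      normRatio P d mu lam p x y = ∑ x, P x * S x ^ lam := by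
  set F := ∑ x, P x * S x ^ lam with hFdef
  have hpow : ∀ x, S x ^ lam = S x ^ (lam - 1) * S x := fun x => by
    rw [← Real.rpow_add_one (hS x).ne', sub_add_cancel]
  set p : X × Y → ℝ := fun z => P z.1 * S z.1 ^ (lam - 1) * (Q z.2 * e z.1 z.2) / F
  have hpn : ∀ z, 0 ≤ p z := fun z => by
    have := hP z.1
    have := (hS z.1).le
    have := hQ.1 z.2
    have := (he z.1 z.2).le
    positivity
  have hmX : ∀ x, margX p x = P x * S x ^ lam / F := fun x => by
    simp only [margX, p]
    rw [← Finset.sum_div, ← Finset.mul_sum, ← hSQ, hpow]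
    ring
  have hmY : ∀ y, margY p y = Q y * (∑ x, P x * S x ^ (lam - 1) * e x y) / F := fun y => by
    simp only [margY, p]
    rw [← Finset.sum_div, Finset.mul_sum]
    congr 1
    exact Finset.sum_congr rfl fun x _ => by ring
  have hgQ : ∑ y, Q y * (∑ x, P x * S x ^ (lam - 1) * e x y) = F := by
    simp only [Finset.mul_sum]
    rw [Finset.sum_comm]
    refine Finset.sum_congr rfl fun x _ => ?_
    rw [hpow, hSQ, Finset.mul_sum, Finset.mul_sum]
    exact Finset.sum_congr rfl fun y _ => by ring
  -- Complementary slackness: the `Q`-average of the nonnegative slacks vanishes, so the first-order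
  -- condition is an equality wherever `Q y > 0`.
  have hmY' : ∀ y, margY p y = Q y := fun y => by
    have hnn : ∀ y ∈ Finset.univ, 0 ≤ Q y * (F - ∑ x, P x * S x ^ (lam - 1) * e x y) :=
      fun y _ => mul_nonneg (hQ.1 y) (sub_nonneg.2 (hg y))
    have hz : ∑ y, Q y * (F - ∑ x, P x * S x ^ (lam - 1) * e x y) = 0 := by
      simp only [mul_sub, Finset.sum_sub_distrib]
      rw [← Finset.sum_mul, hQ.2, hgQ]; ring
    have := (Finset.sum_eq_zero_iff_of_nonneg hnn).1 hz y (Finset.mem_univ y)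
    rw [hmY, div_eq_iff hF.ne']
    linarith
  refine ⟨p, ⟨⟨hpn, ?_⟩, fun x hx => by rw [hmX, hx]; simp⟩, fun x y hxy => ?_⟩
  · rw [Fintype.sum_prod_type]
    change ∑ x, margX p x = 1
    simp only [hmX]
    rw [← Finset.sum_div, div_self hF.ne']
  · have hPx : 0 < P x := lt_of_le_of_ne (hP x) fun h => by simp [p, ← h] at hxy
    have hQy : 0 < Q y := lt_of_le_of_ne (hQ.1 y) fun h => by simp [p, ← h] at hxy
    have hSx := hS x
    have hex := he x y
    rw [normRatio, condXY, hmX, hmY', ← hel]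
    have e1 : p (x, y) / Q y = P x / F * (S x ^ (lam - 1) * e x y) := by
      simp only [p]; field_simp
    have e2 : (P x / F) ^ (1 - lam) * (P x / F) ^ lam = P x / F := by
      rw [← Real.rpow_add (by positivity)]; simp
    have e3 : (S x ^ lam) ^ (1 - lam) * (S x ^ (lam - 1)) ^ lam = 1 := by
      rw [← Real.rpow_mul hSx.le, ← Real.rpow_mul hSx.le, ← Real.rpow_add hSx,
        show lam * (1 - lam) + (lam - 1) * lam = 0 by ring, Real.rpow_zero]
    rw [e1, show P x * S x ^ lam / F = P x / F * S x ^ lam by ring,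
      Real.mul_rpow (by positivity) (by positivity), Real.mul_rpow (by positivity) (by positivity),
      Real.mul_rpow (by positivity) hex.le]
    have e4 : (P x / F) ^ (1 - lam) * (S x ^ lam) ^ (1 - lam) *
        ((P x / F) ^ lam * ((S x ^ (lam - 1)) ^ lam * e x y ^ lam)) = P x / F * e x y ^ lam := by
      calc _ = ((P x / F) ^ (1 - lam) * (P x / F) ^ lam) *
          ((S x ^ lam) ^ (1 - lam) * (S x ^ (lam - 1)) ^ lam) * e x y ^ lam := by ring
        _ = _ := by rw [e2, e3]; ring
    rw [e4]
    have := Real.rpow_pos_of_pos hex lam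
    field_simp

/-- The distribution `P(x) 1[y = f x]`. -/
lemma exists_graph_dist {P : X → ℝ} (hP : P ∈ stdSimplex ℝ X) (f : X → Y) :
    ∃ r ∈ acDist Y P, (∀ x, margX r x = P x) ∧ ∀ x y, r (x, y) ≠ 0 → y = f x := by
  classical
  have hm : ∀ x, margX (fun z : X × Y => if z.2 = f z.1 then P z.1 else 0) x = P x := fun x => by
    simp [margX]
  refine ⟨fun z => if z.2 = f z.1 then P z.1 else 0, ⟨⟨fun z => ?_, ?_⟩, fun x hx => ?_⟩, hm,
    fun x y h => ?_⟩
  · dsimp only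
    split_ifs
    · exact hP.1 _
    · exact le_rfl
  · rw [Fintype.sum_prod_type, ← hP.2]
    exact Finset.sum_congr rfl fun x _ => hm x
  · rw [hm, hx]
  · by_contra h'
    simp [h'] at h

/-- The optimal normalization factor, together with the distribution attaining it and the
converse bound that it provides for every block code. -/
lemma exists_saddle {P : X → ℝ} (hP : P ∈ stdSimplex ℝ X) {d : X → Y → ℝ}
    (hd : ∀ x y, 0 ≤ d x y) (hd0 : ∀ x, ∃ y, d x y = 0) {mu lam : ℝ} (hmu : 0 ≤ mu)
    (hl : lam ∈ Set.Icc (0 : ℝ) 1) :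
    ∃ F > (0 : ℝ), (∃ p ∈ acDist Y P, ∀ x y, 0 < p (x, y) → normRatio P d mu lam p x y = F) ∧
      (∀ p ∈ stdSimplex ℝ (X × Y), normFactor P d mu lam p ≤ F) ∧
      ∀ (Δ : ℝ) (k M : ℕ) (φ : (Fin k → X) → Fin M) (ψ : Fin M → (Fin k → Y)), 0 ≤ Δ →
        probCorrect P d Δ φ ψ ≤ Real.exp (mu * (k * Δ)) * (M : ℝ) ^ lam * F ^ k := by
  have hX : Nonempty X := by
    by_contra h
    rw [not_nonempty_iff] at h
    simpa using hP.2
  have hY : Nonempty Y := hX.map fun x => (hd0 x).choose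
  rcases hl.1.eq_or_lt with rfl | hl0
  -- At `lam = 0` the tilting `exp(-μd/lam)` is meaningless. Here `F = 1`, attained by the graph of
  -- a zero-distortion map, and the code bound is trivial.
  · refine ⟨1, one_pos, ?_, fun p hp => ?_, fun Δ k M φ ψ hΔ => ?_⟩
    · choose f hf using hd0
      obtain ⟨r, hr, hrm, hrf⟩ := exists_graph_dist hP f
      refine ⟨r, hr, fun x y hxy => ?_⟩
      have hPx : P x ≠ 0 := fun h => hxy.ne' (eq_zero_of_acDist hr h y)
      have hy := hrf x y hxy.ne'
      simp [normRatio, hrm, hy, hf, hPx]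
    · have : ∀ x, ∑ y, p (x, y) * normRatio P d mu 0 p x y ≤ P x := fun x => by
        have h1 : ∀ y, p (x, y) * normRatio P d mu 0 p x y ≤ p (x, y) / margX p x * P x := by
          intro y
          have : Real.exp (-(mu * d x y)) ≤ 1 :=
            Real.exp_le_one_iff.2 (neg_nonpos.2 (mul_nonneg hmu (hd x y)))
          have h2 : 0 ≤ p (x, y) / margX p x * P x :=
            mul_nonneg (div_nonneg (hp.1 _) (margX_nonneg hp.1 x)) (hP.1 x)
          calc _ = p (x, y) / margX p x * P x * Real.exp (-(mu * d x y)) := by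
                simp [normRatio]; ring
            _ ≤ _ := mul_le_of_le_one_right h2 this
        refine (Finset.sum_le_sum fun y _ => h1 y).trans ?_
        rw [← Finset.sum_mul, ← Finset.sum_div]
        exact mul_le_of_le_one_left (hP.1 x) (div_self_le_one _)
      exact (Finset.sum_le_sum fun x _ => this x).trans hP.2.le
    · rw [Real.rpow_zero, one_pow, mul_one, mul_one]
      exact (probCorrect_le_one hP d Δ φ ψ).trans (Real.one_le_exp (by positivity))
  · have he : ∀ x y, 0 < Real.exp (-(mu * d x y) / lam) := fun x y => Real.exp_pos _
    have hel : ∀ x y, Real.exp (-(mu * d x y) / lam) ^ lam = Real.exp (-(mu * d x y)) :=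
      fun x y => by rw [← Real.exp_mul, div_mul_cancel₀ _ hl0.ne']
    obtain ⟨Q, hQ, hS, hg⟩ := exists_maximizer P he hl0
    have hF : 0 < ∑ x, P x * (∑ y', Q y' * Real.exp (-(mu * d x y') / lam)) ^ lam := by
      have h0 : ∀ x ∈ Finset.univ,
          0 ≤ P x * (∑ y', Q y' * Real.exp (-(mu * d x y') / lam)) ^ lam :=
        fun x _ => mul_nonneg (hP.1 x) (Real.rpow_nonneg (hS x).le _)
      refine lt_of_le_of_ne (Finset.sum_nonneg h0) fun h => ?_
      have hz := (Finset.sum_eq_zero_iff_of_nonneg h0).1 h.symm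
      have : ∑ x, P x = 0 := Finset.sum_eq_zero fun x hx =>
        (mul_eq_zero.1 (hz x hx)).resolve_right (Real.rpow_pos_of_pos (hS x) _).ne'
      rw [hP.2] at this
      exact one_ne_zero this
    exact ⟨_, hF, exists_normRatio_eq hP.1 he hel hQ (fun _ => rfl) hS hF hg,
      fun p hp => normFactor_le hP.1 hl0 hl.2 he hel hS hg hp,
      fun Δ k M φ ψ _ => probCorrect_le_of_tangent hP hmu hl0 hl.2 he hel hS hg Δ φ ψ⟩

/-- Together with `normFactor`, this presents the Lagrangian and the normalisation as `E[-log ρ]`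
and `E[ρ]` for the same ratio `ρ`, so Jensen's inequality compares them. -/
lemma objective_eq {P : X → ℝ} (hP : ∀ x, 0 ≤ P x) (d : X → Y → ℝ) (mu lam : ℝ) {p : X × Y → ℝ}
    (hp : p ∈ acDist Y P) :
    lam * mutualInfo p + divX P p + mu * expDist d p =
      ∑ x, ∑ y, p (x, y) * -Real.log (normRatio P d mu lam p x y) := by
  rw [divX_eq_sum, mutualInfo, expDist]
  simp only [Finset.mul_sum, ← Finset.sum_add_distrib]
  refine Finset.sum_congr rfl fun x _ => Finset.sum_congr rfl fun y _ => ?_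
  rcases (hp.1.1 (x, y)).eq_or_lt with h | h
  · simp [← h]
  have h1 : 0 < margX p x := h.trans_le (le_margX hp.1.1 x y)
  have h2 : 0 < margY p y := h.trans_le (le_margY hp.1.1 x y)
  have h3 : 0 < P x := lt_of_le_of_ne (hP x) fun e => h1.ne' (hp.2 x e.symm)
  have h4 : 0 < p (x, y) / margY p y := div_pos h h2
  have h5 : Real.log (normRatio P d mu lam p x y) = Real.log (P x) - mu * d x y -
      ((1 - lam) * Real.log (margX p x) +
        lam * (Real.log (p (x, y)) - Real.log (margY p y))) := by
    rw [normRatio, condXY, Real.log_div (by positivity) (by positivity),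
      Real.log_mul h3.ne' (Real.exp_pos _).ne', Real.log_exp,
      Real.log_mul (by positivity) (by positivity), Real.log_rpow h1, Real.log_rpow h4,
      Real.log_div h.ne' h2.ne']
    ring
  rw [h5, Real.log_div h.ne' (by positivity), Real.log_mul h1.ne' h2.ne',
    Real.log_div h1.ne' h3.ne']
  ring

/-- Jensen's inequality in tangent form: `log t ≤ t - 1` at `t = normRatio / F`, averaged over `p`.
-/
lemma neg_log_le_objective {P : X → ℝ} (hP : ∀ x, 0 ≤ P x) {d : X → Y → ℝ} {mu lam F : ℝ}
    (hF : 0 < F) {p : X × Y → ℝ} (hp : p ∈ acDist Y P) (hle : normFactor P d mu lam p ≤ F) :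
    -Real.log F ≤ lam * mutualInfo p + divX P p + mu * expDist d p := by
  rw [objective_eq hP d mu lam hp]
  have key : ∀ x y, p (x, y) * -Real.log F + p (x, y) - p (x, y) * normRatio P d mu lam p x y / F ≤
      p (x, y) * -Real.log (normRatio P d mu lam p x y) := by
    intro x y
    rcases (hp.1.1 (x, y)).eq_or_lt with h | h
    · simp [← h]
    have h1 : 0 < margX p x := h.trans_le (le_margX hp.1.1 x y)
    have h2 : 0 < margY p y := h.trans_le (le_margY hp.1.1 x y)
    have h3 : 0 < P x := lt_of_le_of_ne (hP x) fun e => h1.ne' (hp.2 x e.symm)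
    have h4 : 0 < normRatio P d mu lam p x y := by
      unfold normRatio condXY; positivity
    have := Real.log_le_sub_one_of_pos (div_pos h4 hF)
    rw [Real.log_div h4.ne' hF.ne'] at this
    have := mul_le_mul_of_nonneg_left this h.le
    rw [mul_sub, mul_sub, mul_one, ← mul_div_assoc] at this
    linarith
  have hsum := Finset.sum_le_sum fun x (_ : x ∈ Finset.univ) =>
    Finset.sum_le_sum fun y (_ : y ∈ Finset.univ) => key x y
  refine le_trans ?_ hsum
  simp only [Finset.sum_sub_distrib, Finset.sum_add_distrib, ← Finset.sum_mul, ← Finset.sum_div]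
  rw [sum_sum_eq_one hp.1]
  have : (∑ x, ∑ y, p (x, y) * normRatio P d mu lam p x y) / F ≤ 1 := (div_le_one hF).2 hle
  linarith

lemma objective_eq_neg_log {P : X → ℝ} (hP : ∀ x, 0 ≤ P x) {d : X → Y → ℝ} {mu lam F : ℝ}
    {p : X × Y → ℝ} (hp : p ∈ acDist Y P)
    (h : ∀ x y, 0 < p (x, y) → normRatio P d mu lam p x y = F) :
    lam * mutualInfo p + divX P p + mu * expDist d p = -Real.log F := by
  rw [objective_eq hP d mu lam hp]
  calc _ = ∑ x, ∑ y, p (x, y) * -Real.log F := by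
        refine Finset.sum_congr rfl fun x _ => Finset.sum_congr rfl fun y _ => ?_
        rcases (hp.1.1 (x, y)).eq_or_lt with h' | h'
        · simp [← h']
        · rw [h x y h']
    _ = _ := by simp only [← Finset.sum_mul]; rw [sum_sum_eq_one hp.1, one_mul]

lemma normFactor_eq_of_normRatio {P : X → ℝ} {d : X → Y → ℝ} {mu lam F : ℝ}
    {p : X × Y → ℝ} (hp : p ∈ stdSimplex ℝ (X × Y))
    (h : ∀ x y, 0 < p (x, y) → normRatio P d mu lam p x y = F) :
    normFactor P d mu lam p = F := by
  calc _ = ∑ x, ∑ y, p (x, y) * F := by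
        refine Finset.sum_congr rfl fun x _ => Finset.sum_congr rfl fun y _ => ?_
        change p (x, y) * normRatio P d mu lam p x y = _
        rcases (hp.1 (x, y)).eq_or_lt with h' | h'
        · simp [← h']
        · rw [h x y h']
    _ = _ := by simp only [← Finset.sum_mul]; rw [sum_sum_eq_one hp, one_mul]

/-! ### Tail estimates -/

/-- Chernoff bound for i.i.d. sequences over a finite alphabet. -/
lemma exists_chernoff {Z : Type*} [Fintype Z] {q : Z → ℝ} (hq : q ∈ stdSimplex ℝ Z) (f : Z → ℝ)
    {a : ℝ} (ha : ∑ z, q z * f z < a) :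
    ∃ ρ ∈ Set.Ico (0 : ℝ) 1, ∀ k : ℕ,
      (∑ z : Fin k → Z, if k * a < ∑ i, f (z i) then ∏ i, q (z i) else 0) ≤ ρ ^ k := by
  have hder : HasDerivAt (fun s : ℝ => ∑ z, q z * Real.exp (s * (f z - a)))
      (∑ z, q z * (f z - a)) 0 := by
    refine HasDerivAt.fun_sum fun z _ => HasDerivAt.const_mul _ ?_
    have h1 : HasDerivAt (fun s : ℝ => s * (f z - a)) (f z - a) 0 := by
      simpa using (hasDerivAt_id (0 : ℝ)).mul_const (f z - a)
    simpa using h1.exp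
  have hneg : ∑ z, q z * (f z - a) < 0 := by
    simp only [mul_sub, Finset.sum_sub_distrib]
    rw [← Finset.sum_mul, hq.2]
    linarith
  -- The exponential moment equals `1` at `s = 0` with negative derivative, so it is below `1` at
  -- some `s > 0`; that value is `ρ`.
  have hev := hder.tendsto_slope_zero_right.eventually_lt_const hneg
  obtain ⟨s, hs, hs0⟩ := (hev.and self_mem_nhdsWithin).exists
  simp only [zero_add, smul_eq_mul, zero_mul, Real.exp_zero, mul_one, hq.2] at hs
  have hs0 : 0 < s := hs0
  have hlt : ∑ z, q z * Real.exp (s * (f z - a)) < 1 := by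
    have := (mul_neg_iff.1 hs).resolve_right fun h => (inv_pos.2 hs0).not_gt h.1
    linarith [this.2]
  refine ⟨_, ⟨Finset.sum_nonneg fun z _ => mul_nonneg (hq.1 z) (Real.exp_pos _).le, hlt⟩,
    fun k => ?_⟩
  rw [Fintype.sum_pow]
  refine Finset.sum_le_sum fun z _ => ?_
  have hn : 0 ≤ ∏ i, q (z i) := Finset.prod_nonneg fun _ _ => hq.1 _
  rw [Finset.prod_mul_distrib, ← Real.exp_sum, ← Finset.mul_sum, Finset.sum_sub_distrib]
  split_ifs with h
  · refine le_mul_of_one_le_right hn (Real.one_le_exp (mul_nonneg hs0.le ?_))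
    simp only [Finset.sum_const, Finset.card_univ, Fintype.card_fin, nsmul_eq_mul]
    linarith
  · exact mul_nonneg hn (Real.exp_pos _).le

lemma tendsto_tail_zero {Z : Type*} [Fintype Z] {q : Z → ℝ} (hq : q ∈ stdSimplex ℝ Z) (f : Z → ℝ)
    {a : ℝ} (ha : ∑ z, q z * f z < a) :
    Tendsto (fun k : ℕ => ∑ z : Fin k → Z, if k * a < ∑ i, f (z i) then ∏ i, q (z i) else 0)
      atTop (𝓝 0) := by
  obtain ⟨ρ, hρ, h⟩ := exists_chernoff hq f ha
  refine squeeze_zero (fun k => Finset.sum_nonneg fun z _ => ?_) h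
    (tendsto_pow_atTop_nhds_zero_of_lt_one hρ.1 hρ.2)
  split_ifs
  · exact Finset.prod_nonneg fun _ _ => hq.1 _
  · exact le_rfl

/-! ### Random coding and achievability -/

open Classical in
/-- Random coding: some codebook does at least as well as the average one. -/
lemma exists_codebook {A B : Type*} [Fintype A] [Fintype B] (P : A → ℝ)
    {Q : B → ℝ} (hQ : Q ∈ stdSimplex ℝ B) (rel : A → B → Prop) (M : ℕ) :
    ∃ c : Fin M → B,
      ∑ a, P a * (1 - (1 - ∑ b, if rel a b then Q b else 0) ^ M) ≤
        ∑ a, if ∃ m, rel a (c m) then P a else 0 := by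
  have hB : Nonempty B := by
    by_contra h
    rw [not_nonempty_iff] at h
    simpa using hQ.2
  obtain ⟨c, hc⟩ := Finite.exists_max fun c : Fin M → B => ∑ a, if ∃ m, rel a (c m) then P a else 0
  refine ⟨c, ?_⟩
  have hw := sum_prod_eq_one hQ M
  have hav : ∑ c : Fin M → B, (∏ m, Q (c m)) * (∑ a, if ∃ m, rel a (c m) then P a else 0) ≤
      ∑ a, if ∃ m, rel a (c m) then P a else 0 := by
    calc _ ≤ ∑ c' : Fin M → B, (∏ m, Q (c' m)) * (∑ a, if ∃ m, rel a (c m) then P a else 0) :=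
          Finset.sum_le_sum fun c' _ => mul_le_mul_of_nonneg_left (hc c')
            (Finset.prod_nonneg fun _ _ => hQ.1 _)
      _ = _ := by rw [← Finset.sum_mul, hw, one_mul]
  refine le_trans (le_of_eq ?_) hav
  simp only [Finset.mul_sum]
  rw [Finset.sum_comm]
  refine Finset.sum_congr rfl fun a _ => ?_
  -- The probability of a covered `a` is written as one minus that of no codeword being related to
  -- it; the latter factors over the independent codewords.
  have h1 : ∀ c : Fin M → B, (∏ m, Q (c m)) * (if ∃ m, rel a (c m) then P a else 0) =
      P a * (∏ m, Q (c m) - ∏ m, if rel a (c m) then 0 else Q (c m)) := by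
    intro c
    by_cases h : ∃ m, rel a (c m)
    · obtain ⟨m, hm⟩ := h
      have hz : ∏ m, (if rel a (c m) then 0 else Q (c m)) = 0 :=
        Finset.prod_eq_zero (Finset.mem_univ m) (if_pos hm)
      rw [if_pos ⟨m, hm⟩, hz]
      ring
    · rw [if_neg h]
      have : ∏ m, (if rel a (c m) then 0 else Q (c m)) = ∏ m, Q (c m) :=
        Finset.prod_congr rfl fun m _ => if_neg fun hm => h ⟨m, hm⟩
      rw [this]; ring
  simp only [h1]
  have h3 : ∑ c : Fin M → B, (∏ m, if rel a (c m) then 0 else Q (c m)) =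
      (∑ b, if rel a b then 0 else Q b) ^ M :=
    (Fintype.sum_pow (fun b => if rel a b then 0 else Q b) M).symm
  rw [← Finset.mul_sum, Finset.sum_sub_distrib, hw, h3]
  congr 3
  rw [← hQ.2, ← Finset.sum_sub_distrib]
  refine Finset.sum_congr rfl fun b _ => ?_
  split_ifs <;> ring

/-- From `(1 - p)^M ≤ exp(-Mp) ≤ 1 / (1 + Mp)` and `t / (1 + t) ≥ min 1 t / 2`. It produces the two
regimes behind `max 0 (I - R)`. -/
lemma half_min_le_one_sub_pow {p : ℝ} (hp0 : 0 ≤ p) (hp1 : p ≤ 1) (M : ℕ) :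
    1 / 2 * min 1 (M * p) ≤ 1 - (1 - p) ^ M := by
  have ht : 0 ≤ M * p := by positivity
  have h1 : (1 - p) ^ M ≤ Real.exp (-(M * p)) := by
    calc (1 - p) ^ M ≤ Real.exp (-p) ^ M :=
          pow_le_pow_left₀ (by linarith) (Real.one_sub_le_exp_neg p) M
      _ = _ := by rw [← Real.exp_nat_mul]; ring_nf
  have h2 : Real.exp (-(M * p)) ≤ 1 / (1 + M * p) := by
    rw [Real.exp_neg, ← one_div]
    exact one_div_le_one_div_of_le (by linarith) (by linarith [Real.add_one_le_exp (M * p)])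
  have h3 : 1 / 2 * min 1 (M * p) ≤ 1 - 1 / (1 + M * p) := by
    have e : 1 - 1 / (1 + M * p) = M * p / (1 + M * p) := by
      field_simp; ring
    rw [e, le_div_iff₀ (by linarith)]
    rcases le_total 1 (M * p) with h | h
    · rw [min_eq_left h]; linarith
    · rw [min_eq_right h]; nlinarith
  linarith

open Classical in
/-- One-shot achievability by random coding and change of measure. -/
lemma exists_codebook_of_good {A B : Type*} [Fintype A] [Fintype B] {P : A → ℝ}
    (hP : ∀ a, 0 ≤ P a) {q : A × B → ℝ} (hq : q ∈ stdSimplex ℝ (A × B)) (rel : A → B → Prop)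
    (good : A → B → Prop) {α β : ℝ}
    (h1 : ∀ a b, good a b → 0 < q (a, b) →
      q (a, b) ≤ Real.exp α * (margX q a * margY q b) ∧ margX q a ≤ Real.exp β * P a ∧ rel a b)
    (M : ℕ) :
    ∃ c : Fin M → B,
      1 / 2 * Real.exp (-β) * min 1 (M * Real.exp (-α)) *
          (∑ a, ∑ b, if good a b then q (a, b) else 0) ≤
        ∑ a, if ∃ m, rel a (c m) then P a else 0 := by
  obtain ⟨c, hc⟩ := exists_codebook P (margY_mem hq) rel M
  refine ⟨c, le_trans ?_ hc⟩
  rw [Finset.mul_sum]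
  refine Finset.sum_le_sum fun a _ => ?_
  set G := ∑ b, if good a b then q (a, b) else 0 with hG
  set p := ∑ b, if rel a b then margY q b else 0 with hp
  have hp0 : 0 ≤ p := Finset.sum_nonneg fun b _ => by
    split_ifs
    · exact margY_nonneg hq.1 b
    · exact le_rfl
  have hp1 : p ≤ 1 := by
    rw [← (margY_mem hq).2]
    refine Finset.sum_le_sum fun b _ => ?_
    split_ifs
    · exact le_rfl
    · exact margY_nonneg hq.1 b
  have hG0 : 0 ≤ G := Finset.sum_nonneg fun b _ => by
    split_ifs
    · exact hq.1 _
    · exact le_rfl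
  have hmin := half_min_le_one_sub_pow hp0 hp1 M
  have hmin0 : 0 ≤ min 1 (M * p) := le_min zero_le_one (by positivity)
  rcases hG0.eq_or_lt with h0 | hGpos
  · rw [← h0, mul_zero]
    exact mul_nonneg (hP a) (by linarith)
  obtain ⟨b₀, hb₀⟩ : ∃ b, 0 < if good a b then q (a, b) else 0 := by
    by_contra! h
    exact hGpos.not_ge (Finset.sum_nonpos fun b _ => h b)
  have hgood : good a b₀ := by
    by_contra h
    simp [h] at hb₀
  rw [if_pos hgood] at hb₀
  have hX : 0 < margX q a := hb₀.trans_le (le_margX hq.1 a b₀)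
  have hPa : Real.exp (-β) * margX q a ≤ P a := by
    have := mul_le_mul_of_nonneg_left (h1 a b₀ hgood hb₀).2.1 (Real.exp_pos (-β)).le
    rwa [← mul_assoc, ← Real.exp_add, neg_add_cancel, Real.exp_zero, one_mul] at this
  have hGX : G / margX q a ≤ 1 := by
    rw [div_le_one hX]
    refine Finset.sum_le_sum fun b _ => ?_
    split_ifs
    · exact le_rfl
    · exact hq.1 _
  -- Change of measure: on good pairs `q` is at most `exp α` times the product of its marginals, so
  -- the covering probability `p` is at least `exp(-α)` times the conditional good mass `G / margX q
  -- a`.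
  have hGp : G ≤ Real.exp α * margX q a * p := by
    rw [hG, hp, Finset.mul_sum]
    refine Finset.sum_le_sum fun b _ => ?_
    have hnn : 0 ≤ Real.exp α * margX q a * (if rel a b then margY q b else 0) := by
      refine mul_nonneg (by positivity) ?_
      split_ifs
      · exact margY_nonneg hq.1 b
      · exact le_rfl
    by_cases hg : good a b
    · rw [if_pos hg]
      rcases (hq.1 (a, b)).eq_or_lt with h | h
      · rw [← h]; exact hnn
      · obtain ⟨h2, -, h3⟩ := h1 a b hg h
        rw [if_pos h3, mul_assoc]
        exact h2
    · rw [if_neg hg]; exact hnn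
  have hGp' : Real.exp (-α) * (G / margX q a) ≤ p := by
    rw [← mul_div_assoc, div_le_iff₀ hX]
    have := mul_le_mul_of_nonneg_left hGp (Real.exp_pos (-α)).le
    rw [← mul_assoc, ← mul_assoc, ← Real.exp_add, neg_add_cancel, Real.exp_zero, one_mul] at this
    linarith
  have hr0 : 0 ≤ G / margX q a := by positivity
  have hmm : min 1 (M * Real.exp (-α)) * (G / margX q a) ≤ min 1 (M * p) := by
    refine le_min ?_ ?_
    · exact mul_le_one₀ (min_le_left _ _) hr0 hGX
    · calc _ ≤ M * Real.exp (-α) * (G / margX q a) :=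
            mul_le_mul_of_nonneg_right (min_le_right _ _) hr0
        _ = M * (Real.exp (-α) * (G / margX q a)) := by ring
        _ ≤ M * p := mul_le_mul_of_nonneg_left hGp' (by positivity)
  calc 1 / 2 * Real.exp (-β) * min 1 (M * Real.exp (-α)) * G
      = Real.exp (-β) * margX q a *
          (1 / 2 * (min 1 (M * Real.exp (-α)) * (G / margX q a))) := by field_simp
    _ ≤ P a * (1 - (1 - p) ^ M) := by
      refine mul_le_mul hPa ?_ ?_ (hP a)
      · linarith
      · have : 0 ≤ min 1 (M * Real.exp (-α)) := le_min zero_le_one (by positivity)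
        positivity

/-- The `k`-fold product of a joint distribution, as a distribution on pairs of sequences. -/
noncomputable def prodDist (q : X × Y → ℝ) (k : ℕ) (z : (Fin k → X) × (Fin k → Y)) : ℝ :=
  ∏ i, q (z.1 i, z.2 i)

lemma margX_prodDist (q : X × Y → ℝ) (k : ℕ) (x : Fin k → X) :
    margX (prodDist q k) x = ∏ i, margX q (x i) :=
  (Fintype.prod_sum fun i y => q (x i, y)).symm

lemma margY_prodDist (q : X × Y → ℝ) (k : ℕ) (y : Fin k → Y) :
    margY (prodDist q k) y = ∏ i, margY q (y i) :=
  (Fintype.prod_sum fun i x => q (x, y i)).symm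

lemma sum_sum_eq_sum_prod (k : ℕ) (F : (Fin k → X × Y) → ℝ) :
    ∑ x : Fin k → X, ∑ y : Fin k → Y, F (fun i => (x i, y i)) = ∑ z, F z := by
  rw [← Fintype.sum_prod_type' (f := fun (x : Fin k → X) (y : Fin k → Y) => F fun i => (x i, y i))]
  exact Fintype.sum_equiv (Equiv.arrowProdEquivProdArrow (Fin k) (fun _ => X) (fun _ => Y)).symm _ _
    fun z => rfl

lemma prodDist_mem {q : X × Y → ℝ} (hq : q ∈ stdSimplex ℝ (X × Y)) (k : ℕ) :
    prodDist q k ∈ stdSimplex ℝ ((Fin k → X) × (Fin k → Y)) := by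
  refine ⟨fun z => Finset.prod_nonneg fun _ _ => hq.1 _, ?_⟩
  rw [Fintype.sum_prod_type, ← sum_prod_eq_one hq k]
  exact sum_sum_eq_sum_prod k fun z => ∏ i, q (z i)

/-- Strict slack gives exponential decay. Without slack, as at `Δ = 0`, the tail vanishes
identically if `q` charges only zero-distortion pairs. -/
lemma tendsto_distortion_tail {d : X → Y → ℝ} {q : X × Y → ℝ} (hq : q ∈ stdSimplex ℝ (X × Y))
    {Δ : ℝ} (hΔ : 0 ≤ Δ) (h : expDist d q < Δ ∨ ∀ x y, 0 < q (x, y) → d x y = 0) :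
    Tendsto (fun k : ℕ => ∑ z : Fin k → X × Y,
      if k * Δ < ∑ i, d (z i).1 (z i).2 then ∏ i, q (z i) else 0) atTop (𝓝 0) := by
  rcases h with h | h
  · refine tendsto_tail_zero hq (fun z => d z.1 z.2) (lt_of_eq_of_lt ?_ h)
    rw [Fintype.sum_prod_type]; rfl
  · refine tendsto_const_nhds.congr fun k => (Finset.sum_eq_zero fun z _ => ?_).symm
    split_ifs with hz
    · by_contra hne
      have hpos : ∀ i, 0 < q (z i) := fun i => lt_of_le_of_ne (hq.1 _) fun e =>
        hne (Finset.prod_eq_zero (Finset.mem_univ i) e.symm)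
      have : ∑ i, d (z i).1 (z i).2 = 0 := Finset.sum_eq_zero fun i _ => h _ _ (hpos i)
      rw [this] at hz
      exact hz.not_ge (by positivity)
    · rfl

open Classical in
-- The information density and the log-likelihood ratio have `q`-means `I` and `∑ q_X log (q_X /
-- P)`; each of the three conditions fails with vanishing probability, and a union bound concludes.
lemma eventually_half_le_good {P : X → ℝ} {d : X → Y → ℝ} {q : X × Y → ℝ}
    (hq : q ∈ stdSimplex ℝ (X × Y)) {Δ ε : ℝ} (hΔ : 0 ≤ Δ) (hε : 0 < ε)
    (h : expDist d q < Δ ∨ ∀ x y, 0 < q (x, y) → d x y = 0) :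
    ∀ᶠ k : ℕ in atTop, 1 / 2 ≤ ∑ x : Fin k → X, ∑ y : Fin k → Y,
      if (∑ i, Real.log (q (x i, y i) / (margX q (x i) * margY q (y i))) ≤
            k * (mutualInfo q + ε) ∧
          ∑ i, Real.log (margX q (x i) / P (x i)) ≤ k * (divX P q + ε) ∧
          ∑ i, d (x i) (y i) ≤ k * Δ) then prodDist q k (x, y) else 0 := by
  have t1 := tendsto_tail_zero hq (fun z => Real.log (q z / (margX q z.1 * margY q z.2)))
    (a := mutualInfo q + ε) (by
      rw [Fintype.sum_prod_type]
      exact lt_add_of_pos_right _ hε)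
  have t2 := tendsto_tail_zero hq (fun z => Real.log (margX q z.1 / P z.1))
    (a := divX P q + ε) (by
      rw [Fintype.sum_prod_type, ← divX_eq_sum]
      exact lt_add_of_pos_right _ hε)
  have t3 := tendsto_distortion_tail hq hΔ h
  have t := (t1.add t2).add t3
  simp only [add_zero] at t
  filter_upwards [t.eventually_le_const (show (0 : ℝ) < 1 / 2 by norm_num)] with k hk
  refine le_trans ?_ (le_of_eq (sum_sum_eq_sum_prod k fun z =>
    if (∑ i, Real.log (q (z i) / (margX q (z i).1 * margY q (z i).2)) ≤ k * (mutualInfo q + ε) ∧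
        ∑ i, Real.log (margX q (z i).1 / P (z i).1) ≤ k * (divX P q + ε) ∧
        ∑ i, d (z i).1 (z i).2 ≤ k * Δ) then ∏ i, q (z i) else 0).symm)
  rw [← Finset.sum_add_distrib, ← Finset.sum_add_distrib] at hk
  have hone := sum_prod_eq_one hq k
  have : 1 - 1 / 2 ≤ ∑ z : Fin k → X × Y, ∏ i, q (z i) - ∑ z : Fin k → X × Y, _ :=
    sub_le_sub hone.ge hk
  rw [← Finset.sum_sub_distrib] at this
  refine le_trans (by norm_num) (this.trans (Finset.sum_le_sum fun z _ => ?_))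
  have hn : 0 ≤ ∏ i, q (z i) := Finset.prod_nonneg fun _ _ => hq.1 _
  split_ifs with a1 a2 a3 a4 <;> first | linarith | skip
  all_goals
    exfalso
    grind

/-- Achievability: a joint distribution with small distortion yields good block codes. -/
lemma eventually_exists_code {P : X → ℝ} (hP : ∀ x, 0 ≤ P x) {d : X → Y → ℝ} {R Δ ε : ℝ}
    (hR : 0 ≤ R) (hΔ : 0 ≤ Δ) (hε : 0 < ε) {q : X × Y → ℝ} (hq : q ∈ acDist Y P)
    (h : expDist d q < Δ ∨ ∀ x y, 0 < q (x, y) → d x y = 0) :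
    ∀ᶠ k : ℕ in atTop, ∃ (M : ℕ) (_ : 1 / (k : ℝ) * Real.log M ≤ R)
      (φ : (Fin k → X) → Fin M) (ψ : Fin M → (Fin k → Y)),
      1 / 8 * Real.exp (-(k * (max 0 (mutualInfo q - R) + divX P q + 2 * ε))) ≤
        probCorrect P d Δ φ ψ := by
  classical
  filter_upwards [eventually_half_le_good (P := P) hq.1 hΔ hε h, eventually_gt_atTop 0] with k hk hk0
  have hk' : (0 : ℝ) < k := by exact_mod_cast hk0
  have hexp1 : 1 ≤ Real.exp (k * R) := Real.one_le_exp (by positivity)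
  -- As `R ≥ 0`, the floor is at least `1` and loses at most a factor `2`.
  set M := ⌊Real.exp (k * R)⌋₊ with hM
  have hM1 : 1 ≤ M := Nat.le_floor (by simpa using hexp1)
  have hM1' : (1 : ℝ) ≤ M := by exact_mod_cast hM1
  have hMle : (M : ℝ) ≤ Real.exp (k * R) := Nat.floor_le (Real.exp_pos _).le
  have hMge : Real.exp (k * R) / 2 ≤ M := by
    have := Nat.lt_floor_add_one (Real.exp (k * R))
    rw [← hM] at this
    linarith
  obtain ⟨c, hc⟩ := exists_codebook_of_good (A := Fin k → X) (B := Fin k → Y)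
    (P := fun x => ∏ i, P (x i)) (fun x => Finset.prod_nonneg fun _ _ => hP _)
    (prodDist_mem hq.1 k) (fun x y => avgDist d x y ≤ Δ)
    (fun x y => ∑ i, Real.log (q (x i, y i) / (margX q (x i) * margY q (y i))) ≤
            k * (mutualInfo q + ε) ∧
          ∑ i, Real.log (margX q (x i) / P (x i)) ≤ k * (divX P q + ε) ∧
          ∑ i, d (x i) (y i) ≤ k * Δ) (α := k * (mutualInfo q + ε)) (β := k * (divX P q + ε))
    (fun x y hg hpos => by
      obtain ⟨g1, g2, g3⟩ := hg
      have hqi : ∀ i, 0 < q (x i, y i) := fun i => lt_of_le_of_ne (hq.1.1 _) fun e =>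
        hpos.ne' (Finset.prod_eq_zero (Finset.mem_univ i) e.symm)
      have hXi : ∀ i, 0 < margX q (x i) := fun i => (hqi i).trans_le (le_margX hq.1.1 _ _)
      have hYi : ∀ i, 0 < margY q (y i) := fun i => (hqi i).trans_le (le_margY hq.1.1 _ _)
      have hPi : ∀ i, 0 < P (x i) := fun i => lt_of_le_of_ne (hP _) fun e =>
        (hXi i).ne' (hq.2 _ e.symm)
      have ratio : ∀ u v : Fin k → ℝ, (∀ i, 0 < u i) → (∀ i, 0 < v i) → ∀ t,
          ∑ i, Real.log (u i / v i) ≤ t → ∏ i, u i ≤ Real.exp t * ∏ i, v i := by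
        intro u v hu hv t ht
        rw [← div_le_iff₀ (Finset.prod_pos fun i _ => hv i), ← Finset.prod_div_distrib]
        rw [← Real.log_prod (fun i _ => (div_pos (hu i) (hv i)).ne')] at ht
        exact (Real.log_le_iff_le_exp (Finset.prod_pos fun i _ => div_pos (hu i) (hv i))).1 ht
      refine ⟨?_, ?_, ?_⟩
      · rw [margX_prodDist, margY_prodDist, ← Finset.prod_mul_distrib]
        exact ratio _ _ hqi (fun i => mul_pos (hXi i) (hYi i)) _ g1
      · rw [margX_prodDist]
        exact ratio _ _ hXi hPi _ g2
      · rw [avgDist, one_div, inv_mul_le_iff₀ hk']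
        exact g3) M
  -- The encoder picks any codeword within distortion `Δ`; the fallback index `0` is used only where
  -- decoding fails anyway.
  refine ⟨M, ?_, fun x => if hx : ∃ m, avgDist d x (c m) ≤ Δ then hx.choose else ⟨0, hM1⟩, c, ?_⟩
  · rw [one_div, inv_mul_le_iff₀ hk', Real.log_le_iff_le_exp (by linarith)]
    exact hMle
  · refine le_trans ?_ (hc.trans (le_of_eq ?_))
    · set I := mutualInfo q
      set D := divX P q
      have hmin : 1 / 2 * Real.exp (-(k * (max 0 (I - R) + ε))) ≤
          min 1 (M * Real.exp (-(k * (I + ε)))) := by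
        refine le_min ?_ ?_
        · have : Real.exp (-(k * (max 0 (I - R) + ε))) ≤ 1 :=
            Real.exp_le_one_iff.2 (neg_nonpos.2 (by positivity))
          linarith [Real.exp_pos (-(k * (max 0 (I - R) + ε)))]
        · calc 1 / 2 * Real.exp (-(k * (max 0 (I - R) + ε)))
              ≤ 1 / 2 * Real.exp (-(k * ((I - R) + ε))) := by
                gcongr
                exact le_max_right _ _
            _ = Real.exp (k * R) / 2 * Real.exp (-(k * (I + ε))) := by
                rw [show -(k * ((I - R) + ε)) = k * R + -(k * (I + ε)) by ring, Real.exp_add]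
                ring
            _ ≤ _ := mul_le_mul_of_nonneg_right hMge (Real.exp_pos _).le
      -- The constant `1 / 8` collects three halves: random coding, rounding of `M`, and the mass of
      -- the good set.
      calc 1 / 8 * Real.exp (-(k * (max 0 (I - R) + D + 2 * ε)))
          = 1 / 2 * Real.exp (-(k * (D + ε))) *
            (1 / 2 * Real.exp (-(k * (max 0 (I - R) + ε)))) * (1 / 2) := by
            rw [show -(k * (max 0 (I - R) + D + 2 * ε)) =
              -(k * (D + ε)) + -(k * (max 0 (I - R) + ε)) by ring, Real.exp_add]
            ring
        _ ≤ _ := by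
            refine mul_le_mul (mul_le_mul_of_nonneg_left hmin (by positivity)) (by convert! hk)
              (by norm_num) ?_
            exact mul_nonneg (by positivity) (le_min zero_le_one (by positivity))
    · refine Finset.sum_congr rfl fun x _ => ?_
      by_cases hx : ∃ m, avgDist d x (c m) ≤ Δ
      · rw [if_pos hx]
        exact (if_pos (by dsimp only; rw [dif_pos hx]; exact hx.choose_spec)).symm
      · rw [if_neg hx, if_neg fun h' => hx ⟨_, h'⟩]

/-! ### Exponents in `EReal` and the parametric value -/

lemma elog_of_pos {t : ℝ} (ht : 0 < t) : elog t = (Real.log t : EReal) :=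
  ENNReal.log_ofReal_of_pos ht

lemma elog_of_nonpos {t : ℝ} (ht : t ≤ 0) : elog t = ⊥ := by
  rw [elog, ENNReal.ofReal_of_nonpos ht, ENNReal.log_zero]

lemma elog_mono {s t : ℝ} (h : s ≤ t) : elog s ≤ elog t :=
  ENNReal.log_monotone (ENNReal.ofReal_le_ofReal h)

lemma coe_le_of_forall_sub_le {g : ℝ} {x : EReal}
    (h : ∀ ε : ℝ, 0 < ε → ((g - ε : ℝ) : EReal) ≤ x) : (g : EReal) ≤ x := by
  induction x with
  | bot => exact absurd (h 1 one_pos) (not_le.2 (EReal.bot_lt_coe _))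
  | top => exact le_top
  | coe x =>
    refine EReal.coe_le_coe_iff.2 (le_of_forall_pos_le_add fun ε hε => ?_)
    linarith [EReal.coe_le_coe_iff.1 (h ε hε)]

lemma relEnt_margX_of_mem {P : X → ℝ} {q : X × Y → ℝ} (hq : q ∈ acDist Y P) :
    relEnt (margX q) P = (divX P q : EReal) :=
  if_pos hq.2

lemma relEnt_margX_of_notMem {P : X → ℝ} {q : X × Y → ℝ} (hq : q ∈ stdSimplex ℝ (X × Y))
    (h : q ∉ acDist Y P) : relEnt (margX q) P = ⊤ :=
  if_neg fun h' => h ⟨hq, h'⟩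

/-- The code bound after taking logarithms, with `log M ≤ kR`; a code that never succeeds has
exponent `⊤`. -/
lemma le_blockExponent {P : X → ℝ} (hP : P ∈ stdSimplex ℝ X) {d : X → Y → ℝ} {R Δ mu lam F : ℝ}
    (hl : 0 ≤ lam) (hF : 0 < F) {k : ℕ} (hk : 0 < k)
    (h : ∀ (M : ℕ) (φ : (Fin k → X) → Fin M) (ψ : Fin M → (Fin k → Y)),
      probCorrect P d Δ φ ψ ≤ Real.exp (mu * (k * Δ)) * (M : ℝ) ^ lam * F ^ k) :
    ((-lam * R - mu * Δ - Real.log F : ℝ) : EReal) ≤ blockExponent P d R Δ k := by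
  have hk' : (0 : ℝ) < k := by exact_mod_cast hk
  refine le_iInf fun M => le_iInf fun hM => le_iInf fun φ => le_iInf fun ψ => ?_
  obtain ⟨x₀⟩ : Nonempty X := by
    by_contra h
    rw [not_nonempty_iff] at h
    simpa using hP.2
  have hM0 : (0 : ℝ) < M := by exact_mod_cast (φ fun _ => x₀).pos
  have hneg : -(1 / (k : ℝ)) < 0 := by
    have : 0 < 1 / (k : ℝ) := by positivity
    linarith
  rcases le_or_gt (probCorrect P d Δ φ ψ) 0 with hp | hp
  · rw [elog_of_nonpos hp, EReal.coe_mul_bot_of_neg hneg]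
    exact le_top
  · rw [elog_of_pos hp, ← EReal.coe_mul, EReal.coe_le_coe_iff]
    have hlog := Real.log_le_log hp (h M φ ψ)
    rw [Real.log_mul (by positivity) (by positivity), Real.log_mul (by positivity) (by positivity),
      Real.log_exp, Real.log_rpow hM0, Real.log_pow] at hlog
    rw [one_div, inv_mul_le_iff₀ hk'] at hM
    have := mul_le_mul_of_nonneg_left hM hl
    have e : -(1 / (k : ℝ)) * Real.log (probCorrect P d Δ φ ψ) =
      -Real.log (probCorrect P d Δ φ ψ) / k := by ring
    rw [e, le_div_iff₀ hk']
    nlinarith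

/-- Properties of the parametric exponent: it is the minimum of a Lagrangian over `acDist`, it has
the expression through `normFactor`, and it bounds the exponent of every block code. -/
lemma exists_param_value {P : X → ℝ} (hP : P ∈ stdSimplex ℝ X) {d : X → Y → ℝ}
    (hd : ∀ x y, 0 ≤ d x y) (hd0 : ∀ x, ∃ y, d x y = 0) (R : ℝ) {Δ : ℝ} (hΔ : 0 ≤ Δ)
    {mu lam : ℝ} (hmu : 0 ≤ mu) (hl : lam ∈ Set.Icc (0 : ℝ) 1) :
    ∃ m v : ℝ, v = -lam * R - mu * Δ + m ∧
      IsLeast ((fun p => -elog (normFactor P d mu lam p)) '' stdSimplex ℝ (X × Y)) (m : EReal) ∧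
      expGParam P d R Δ mu lam = v ∧
      (⨅ p ∈ stdSimplex ℝ (X × Y),
        (((-lam * R - mu * Δ : ℝ) : EReal) + -elog (normFactor P d mu lam p))) = v ∧
      (∀ q ∈ acDist Y P,
        v ≤ lam * (mutualInfo q - R) + divX P q + mu * (expDist d q - Δ)) ∧
      (∃ q ∈ acDist Y P,
        lam * (mutualInfo q - R) + divX P q + mu * (expDist d q - Δ) = v) ∧
      ∀ k : ℕ, 0 < k → (v : EReal) ≤ blockExponent P d R Δ k := by
  obtain ⟨F, hF, ⟨p, hp, hpF⟩, hle, hcode⟩ := exists_saddle hP hd hd0 hmu hl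
  have hnf := normFactor_eq_of_normRatio hp.1 hpF
  have hobj := objective_eq_neg_log hP.1 hp hpF
  have hlb : ∀ q ∈ acDist Y P, -lam * R - mu * Δ + -Real.log F ≤
      lam * (mutualInfo q - R) + divX P q + mu * (expDist d q - Δ) := fun q hq => by
    have := neg_log_le_objective hP.1 hF hq (hle q hq.1)
    linarith
  have hmin : IsLeast ((fun p => -elog (normFactor P d mu lam p)) '' stdSimplex ℝ (X × Y))
      ((-Real.log F : ℝ) : EReal) := by
    refine ⟨⟨p, hp.1, ?_⟩, ?_⟩
    · simp only [hnf, elog_of_pos hF, EReal.coe_neg]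
    · rintro _ ⟨q, hq, rfl⟩
      rw [EReal.coe_neg, ← elog_of_pos hF]
      exact EReal.neg_le_neg_iff.2 (elog_mono (hle q hq))
  refine ⟨-Real.log F, -lam * R - mu * Δ + -Real.log F, rfl, hmin, ?_, ?_, hlb,
    ⟨p, hp, by linarith⟩, fun k hk => le_blockExponent hP hl.1 hF hk fun M φ ψ =>
      hcode Δ k M φ ψ hΔ⟩
  · refine le_antisymm (iInf₂_le_of_le p hp.1 ?_) (le_iInf₂ fun q hq => ?_)
    · rw [relEnt_margX_of_mem hp, ← EReal.coe_add, EReal.coe_le_coe_iff]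
      linarith
    · by_cases hac : q ∈ acDist Y P
      · rw [relEnt_margX_of_mem hac, ← EReal.coe_add, EReal.coe_le_coe_iff]
        linarith [hlb q hac]
      · rw [relEnt_margX_of_notMem hq hac, EReal.coe_add_top]
        exact le_top
  · refine le_antisymm (iInf₂_le_of_le p hp.1 ?_) (le_iInf₂ fun q hq => ?_)
    · rw [hnf, elog_of_pos hF, EReal.coe_add, EReal.coe_neg]
    · rw [EReal.coe_add]
      exact add_le_add_right (hmin.2 ⟨q, hq, rfl⟩) _

/-! ### Duality for `G` and attainment of the supremum over `μ` -/

/-- On this domain the function is `max D (I + D - R)`, a maximum of two convex functions. -/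
lemma convexOn_exponent {P : X → ℝ} (hP : ∀ x, 0 ≤ P x) (R : ℝ) :
    ConvexOn ℝ (acDist Y P) fun q => max 0 (mutualInfo q - R) + divX P q := by
  have h := (convexOn_divX (Y := Y) hP).sup ((convexOn_mutualInfo_add_divX (Y := Y) P).add_const (-R))
  refine h.congr fun q _ => ?_
  change max (divX P q) (mutualInfo q + divX P q + -R) = _
  rw [← max_add_add_right]
  congr 1 <;> ring

lemma continuousOn_exponent (P : X → ℝ) (R : ℝ) :
    ContinuousOn (fun q => max 0 (mutualInfo q - R) + divX P q) (acDist Y P) := by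
  have h : ContinuousOn (fun q => max (divX P q) (mutualInfo q + divX P q + -R)) (acDist Y P) :=
    (continuousOn_divX P).sup ((continuousOn_mutualInfo_add_divX P).add continuousOn_const)
  refine h.congr fun q _ => ?_
  dsimp only
  rw [← max_add_add_right]
  congr 1 <;> ring

/-- Supplies a feasible point for every `Δ ≥ 0`, and a strictly feasible one when `Δ > 0`. -/
lemma exists_zero_distortion {P : X → ℝ} (hP : P ∈ stdSimplex ℝ X) {d : X → Y → ℝ}
    (hd0 : ∀ x, ∃ y, d x y = 0) : ∃ r ∈ acDist Y P, expDist d r = 0 := by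
  choose f hf using hd0
  obtain ⟨r, hr, -, hrf⟩ := exists_graph_dist hP f
  refine ⟨r, hr, Finset.sum_eq_zero fun x _ => Finset.sum_eq_zero fun y _ => ?_⟩
  rcases eq_or_ne (r (x, y)) 0 with h | h
  · rw [h, zero_mul]
  · rw [hrf x y h, hf, mul_zero]

lemma exists_expG_minimizer {P : X → ℝ} (hP : P ∈ stdSimplex ℝ X) {d : X → Y → ℝ}
    (hd0 : ∀ x, ∃ y, d x y = 0) (R : ℝ) {Δ : ℝ} (hΔ : 0 ≤ Δ) :
    ∃ q ∈ acDist Y P, expDist d q ≤ Δ ∧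
      (∀ q' ∈ acDist Y P, expDist d q' ≤ Δ → max 0 (mutualInfo q - R) + divX P q ≤
        max 0 (mutualInfo q' - R) + divX P q') ∧
      expG P d R Δ = ((max 0 (mutualInfo q - R) + divX P q : ℝ) : EReal) := by
  obtain ⟨r, hr, hr0⟩ := exists_zero_distortion hP hd0
  have hK : IsCompact (acDist Y P ∩ {q | expDist d q ≤ Δ}) :=
    (isCompact_acDist P).inter_right (isClosed_le (continuous_expDist d) continuous_const)
  obtain ⟨q, hq, hmin⟩ := hK.exists_isMinOn ⟨r, hr, hr0.trans_le hΔ⟩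
    ((continuousOn_exponent P R).mono Set.inter_subset_left)
  refine ⟨q, hq.1, hq.2, fun q' h1 h2 => hmin ⟨h1, h2⟩, le_antisymm ?_ ?_⟩
  · refine iInf_le_of_le q (iInf₂_le_of_le hq.1.1 hq.2 ?_)
    rw [relEnt_margX_of_mem hq.1, ← EReal.coe_add]
  · refine le_iInf fun q' => le_iInf₂ fun h1 h2 => ?_
    by_cases hac : q' ∈ acDist Y P
    · rw [relEnt_margX_of_mem hac, ← EReal.coe_add, EReal.coe_le_coe_iff]
      exact hmin ⟨hac, h2⟩
    · rw [relEnt_margX_of_notMem h1 hac, EReal.coe_add_top]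
      exact le_top

/-- Strong duality between the exponent and its parametric form. -/
lemma exists_dual {P : X → ℝ} (hP : P ∈ stdSimplex ℝ X) {d : X → Y → ℝ}
    (hd0 : ∀ x, ∃ y, d x y = 0) (R : ℝ) {Δ g : ℝ} (hΔ : 0 ≤ Δ)
    (hg : ∀ q ∈ acDist Y P, expDist d q ≤ Δ → g ≤ max 0 (mutualInfo q - R) + divX P q) :
    ∃ lam ∈ Set.Icc (0 : ℝ) 1, ∀ ε > (0 : ℝ), ∃ mu ≥ (0 : ℝ), ∀ q ∈ acDist Y P,
      g - ε ≤ lam * (mutualInfo q - R) + divX P q + mu * (expDist d q - Δ) := by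
  obtain ⟨r, hr, hr0⟩ := exists_zero_distortion hP hd0
  have hA := convexOn_divX (Y := Y) hP.1
  have hB : ConvexOn ℝ (acDist Y P) fun q => mutualInfo q + divX P q + -R :=
    (convexOn_mutualInfo_add_divX (Y := Y) P).add_const (-R)
  have hconv : Convex ℝ {q ∈ acDist Y P | expDist d q ≤ Δ} :=
    (convexOn_expDist d (convex_acDist P)).convex_le Δ
  -- The weight is chosen on the constrained set before `ε`, so one `lam` serves every `ε` and the
  -- maximum over `lam` is attained. Only `mu` depends on `ε`: at `Δ = 0` there is no strictly
  -- feasible point.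
  obtain ⟨lam, hl, hcomb⟩ := exists_convex_comb_ge (g := g) (hA.subset (Set.sep_subset _ _) hconv)
    (hB.subset (Set.sep_subset _ _) hconv) ⟨r, hr, hr0.trans_le hΔ⟩ fun q hq => by
      refine (hg q hq.1 hq.2).trans (le_of_eq ?_)
      rw [← max_add_add_right]
      congr 1 <;> ring
  refine ⟨lam, hl, fun ε hε => ?_⟩
  have hf : ConvexOn ℝ (acDist Y P) fun q =>
      (1 - lam) * divX P q + lam * (mutualInfo q + divX P q + -R) :=
    (hA.smul (sub_nonneg.2 hl.2)).add (hB.smul hl.1)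
  have hfc : ContinuousOn (fun q =>
      (1 - lam) * divX P q + lam * (mutualInfo q + divX P q + -R)) (acDist Y P) :=
    (continuousOn_const.mul (continuousOn_divX P)).add
      (continuousOn_const.mul ((continuousOn_mutualInfo_add_divX P).add continuousOn_const))
  obtain ⟨mu, hmu, h⟩ := exists_multiplier (isCompact_acDist P) hf
    ((convexOn_expDist d (convex_acDist P)).add_const (-Δ)) hfc
    ((continuous_expDist d).continuousOn.add continuousOn_const)
    ⟨r, hr, by simp only [Pi.add_apply, hr0]; linarith⟩ hε
    fun q hq hqΔ => hcomb q ⟨hq, by simp only [Pi.add_apply] at hqΔ; linarith⟩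
  refine ⟨mu, hmu, fun q hq => (h q hq).trans (le_of_eq ?_)⟩
  simp only [Pi.add_apply]
  ring

/-- A minimum of affine functions on a half-line, one of which decreases, attains its maximum. -/
lemma exists_max_of_affine_min {E : Type*} {K : Set E} {a b : E → ℝ} {V : ℝ → ℝ} {L : ℝ}
    (hle : ∀ t, 0 ≤ t → ∀ q ∈ K, V t ≤ a q + t * b q)
    (hex : ∀ t, 0 ≤ t → ∃ q ∈ K, a q + t * b q = V t) (hL : ∀ q ∈ K, |b q| ≤ L)
    (hr : ∃ r ∈ K, b r < 0) : ∃ t, 0 ≤ t ∧ ∀ s, 0 ≤ s → V s ≤ V t := by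
  obtain ⟨r, hrK, hr⟩ := hr
  have hL0 : 0 ≤ L := (abs_nonneg _).trans (hL r hrK)
  have hlip : LipschitzOnWith (Real.toNNReal L) V (Set.Ici 0) := by
    refine LipschitzOnWith.of_le_add_mul' L fun s hs t ht => ?_
    obtain ⟨q, hq, hqt⟩ := hex t ht
    have h1 := hle s hs q hq
    have h2 : (s - t) * b q ≤ L * |s - t| := by
      calc (s - t) * b q ≤ |(s - t) * b q| := le_abs_self _
        _ = |b q| * |s - t| := by rw [abs_mul, mul_comm]
        _ ≤ _ := mul_le_mul_of_nonneg_right (hL q hq) (abs_nonneg _)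
    rw [Real.dist_eq]
    linarith
  -- Beyond `T` the decreasing affine function of `r` has dropped to `V 0` or below, so only `[0,
  -- T]` matters.
  set T := max 0 ((a r - V 0) / (-b r))
  have hT : 0 ≤ T := le_max_left _ _
  obtain ⟨t, ht, hmax⟩ := (isCompact_Icc (a := (0 : ℝ)) (b := T)).exists_isMaxOn
    ⟨0, le_rfl, hT⟩ (hlip.continuousOn.mono fun s hs => hs.1)
  refine ⟨t, ht.1, fun s hs => ?_⟩
  rcases le_or_gt s T with h | h
  · exact hmax ⟨hs, h⟩
  · have h1 := hle s hs r hrK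
    have h2 : (a r - V 0) / (-b r) ≤ s := (le_max_right _ _).trans h.le
    rw [div_le_iff₀ (by linarith)] at h2
    have h3 : V 0 ≤ V t := hmax ⟨le_rfl, hT⟩
    linarith

/-- Prepares the hypothesis of the coding lemma. For `Δ > 0`, a small move towards a zero-distortion
law creates slack at a cost controlled by convexity; for `Δ = 0` the constraint already confines the
support. -/
lemma exists_near_minimizer {P : X → ℝ} (hP : P ∈ stdSimplex ℝ X) {d : X → Y → ℝ}
    (hd : ∀ x y, 0 ≤ d x y) (hd0 : ∀ x, ∃ y, d x y = 0) (R : ℝ) {Δ ε : ℝ} (hΔ : 0 ≤ Δ)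
    (hε : 0 < ε) {q : X × Y → ℝ} (hq : q ∈ acDist Y P) (hqΔ : expDist d q ≤ Δ) :
    ∃ q' ∈ acDist Y P, (expDist d q' < Δ ∨ ∀ x y, 0 < q' (x, y) → d x y = 0) ∧
      max 0 (mutualInfo q' - R) + divX P q' ≤ max 0 (mutualInfo q - R) + divX P q + ε := by
  rcases hΔ.eq_or_lt with rfl | hΔ
  · refine ⟨q, hq, Or.inr fun x y hxy => ?_, by linarith⟩
    have h0 : expDist d q = 0 := le_antisymm hqΔ (expDist_nonneg hd hq.1.1)
    have hn : ∀ x y, 0 ≤ q (x, y) * d x y := fun x y => mul_nonneg (hq.1.1 _) (hd x y)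
    have h1 := (Finset.sum_eq_zero_iff_of_nonneg fun x _ =>
      Finset.sum_nonneg fun y _ => hn x y).1 h0 x (Finset.mem_univ x)
    have h2 := (Finset.sum_eq_zero_iff_of_nonneg fun y _ => hn x y).1 h1 y (Finset.mem_univ y)
    exact (mul_eq_zero.1 h2).resolve_left hxy.ne'
  · obtain ⟨r, hr, hr0⟩ := exists_zero_distortion hP hd0
    set f : (X × Y → ℝ) → ℝ := fun q => max 0 (mutualInfo q - R) + divX P q with hf
    set δ := min 1 (ε / (|f r - f q| + 1)) with hδ
    have hδ0 : 0 < δ := lt_min one_pos (by positivity)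
    have hδ1 : δ ≤ 1 := min_le_left _ _
    have hδε : δ * (|f r - f q| + 1) ≤ ε := by
      rw [← le_div_iff₀ (by positivity)]
      exact min_le_right _ _
    refine ⟨(1 - δ) • q + δ • r, convex_acDist P hq hr (by linarith) hδ0.le (by ring), Or.inl ?_, ?_⟩
    · rw [expDist_comb, hr0]
      nlinarith
    · have := (convexOn_exponent hP.1 R).2 hq hr (show 0 ≤ 1 - δ by linarith) hδ0.le (by ring)
      refine this.trans ?_
      change (1 - δ) * f q + δ * f r ≤ f q + ε
      nlinarith [mul_le_mul_of_nonneg_left (le_abs_self (f r - f q)) hδ0.le]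

lemma eventually_blockExponent_le {P : X → ℝ} (hP : P ∈ stdSimplex ℝ X) {d : X → Y → ℝ}
    (hd : ∀ x y, 0 ≤ d x y) (hd0 : ∀ x, ∃ y, d x y = 0) {R Δ ε : ℝ} (hR : 0 ≤ R) (hΔ : 0 ≤ Δ)
    (hε : 0 < ε) {q : X × Y → ℝ} (hq : q ∈ acDist Y P) (hqΔ : expDist d q ≤ Δ) :
    ∀ᶠ k : ℕ in atTop, blockExponent P d R Δ k ≤
      ((max 0 (mutualInfo q - R) + divX P q + ε : ℝ) : EReal) := by
  -- The budget `ε` is split in four: one part for passing to `q'`, two for the `2 * ε` loss in the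
  -- coding lemma, one for `log 8 / k`.
  obtain ⟨q', hq', hsupp, hle⟩ := exists_near_minimizer hP hd hd0 R hΔ
    (show 0 < ε / 4 by positivity) hq hqΔ
  have hlog : Tendsto (fun k : ℕ => Real.log 8 / k) atTop (𝓝 0) :=
    tendsto_const_div_atTop_nhds_zero_nat _
  filter_upwards [eventually_exists_code hP.1 hR hΔ (show 0 < ε / 4 by positivity) hq' hsupp,
    eventually_gt_atTop 0, hlog.eventually_le_const (show 0 < ε / 4 by positivity)]
    with k hk hk0 hk8
  obtain ⟨M, hM, φ, ψ, hc⟩ := hk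
  have hk' : (0 : ℝ) < k := by exact_mod_cast hk0
  refine iInf₂_le_of_le M hM (iInf₂_le_of_le φ ψ ?_)
  have hpos := lt_of_lt_of_le (by positivity) hc
  rw [elog_of_pos hpos, ← EReal.coe_mul, EReal.coe_le_coe_iff]
  have h1 := Real.log_le_log (by positivity) hc
  rw [Real.log_mul (by norm_num) (Real.exp_pos _).ne', Real.log_exp, one_div, Real.log_inv] at h1
  rw [div_le_iff₀ hk'] at hk8
  have e : -(1 / (k : ℝ)) * Real.log (probCorrect P d Δ φ ψ) =
    -Real.log (probCorrect P d Δ φ ψ) / k := by ring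
  rw [e, div_le_iff₀ hk']
  nlinarith

end LossyCoding

/-! ### The main theorem -/

theorem corollary2 {X Y : Type*} [Fintype X] [Fintype Y]
    (P : X → ℝ) (hP : P ∈ stdSimplex ℝ X)
    (d : X → Y → ℝ) (hd_nonneg : ∀ x y, 0 ≤ d x y) (hd_zero : ∀ x, ∃ y, d x y = 0)
    (R Δ : ℝ) (hR : 0 ≤ R) (hΔ : 0 ≤ Δ) :
    -- the expression of `G^{(μ,λ)}` through a minimum over `p`
    (∀ lam ∈ Set.Icc (0 : ℝ) 1, ∀ mu ∈ Set.Ici (0 : ℝ),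
      ∃ m : EReal,
        IsLeast ((fun p => -elog (normFactor P d mu lam p)) '' stdSimplex ℝ (X × Y)) m ∧
        expGParam P d R Δ mu lam = ((-lam * R - mu * Δ : ℝ) : EReal) + m) ∧
    -- `G* = lim G^{(k)}` exists and equals `G`
    Tendsto (fun k : ℕ => blockExponent P d R Δ k) atTop (𝓝 (expG P d R Δ)) ∧
    -- `G` is the maximum over `λ` of the supremum over `μ` of `G^{(μ,λ)}`
    IsGreatest ((fun lam : ℝ => ⨆ mu ∈ Set.Ici (0 : ℝ), expGParam P d R Δ mu lam) ''
      Set.Icc (0 : ℝ) 1) (expG P d R Δ) ∧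
    -- the same with the minimum over `p` written out
    IsGreatest ((fun lam : ℝ => ⨆ mu ∈ Set.Ici (0 : ℝ), ⨅ p ∈ stdSimplex ℝ (X × Y),
        (((-lam * R - mu * Δ : ℝ) : EReal) + -elog (normFactor P d mu lam p))) ''
      Set.Icc (0 : ℝ) 1) (expG P d R Δ) ∧
    -- for `Δ > 0` the supremum over `μ` is a maximum
    (0 < Δ → ∀ lam ∈ Set.Icc (0 : ℝ) 1, ∃ mu ∈ Set.Ici (0 : ℝ),
      IsMaxOn (fun mu' : ℝ => expGParam P d R Δ mu' lam) (Set.Ici 0) mu ∧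
      IsMaxOn (fun mu' : ℝ => ⨅ p ∈ stdSimplex ℝ (X × Y),
        (((-lam * R - mu' * Δ : ℝ) : EReal) + -elog (normFactor P d mu' lam p)))
        (Set.Ici 0) mu) := by
  classical
  have hval := fun {lam : ℝ} (hl : lam ∈ Set.Icc (0 : ℝ) 1) {mu : ℝ} (hmu : 0 ≤ mu) =>
    exists_param_value hP hd_nonneg hd_zero R hΔ hmu hl
  obtain ⟨q₀, hq₀, hqΔ, hqmin, hG⟩ := exists_expG_minimizer hP hd_zero R hΔ
  set g : ℝ := max 0 (mutualInfo q₀ - R) + divX P q₀ with hg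
  obtain ⟨lams, hls, hdual⟩ := exists_dual hP hd_zero R hΔ hqmin
  have hstrong : ∀ ε : ℝ, 0 < ε → ∃ mu ≥ (0 : ℝ), ((g - ε : ℝ) : EReal) ≤
      expGParam P d R Δ mu lams := fun ε hε => by
    obtain ⟨mu, hmu, h⟩ := hdual ε hε
    obtain ⟨m, v, -, -, hv, -, -, ⟨q, hq, hqv⟩, -⟩ := hval hls hmu
    refine ⟨mu, hmu, ?_⟩
    rw [hv, EReal.coe_le_coe_iff, ← hqv]
    exact h q hq
  have hweak : ∀ lam ∈ Set.Icc (0 : ℝ) 1, ∀ mu ∈ Set.Ici (0 : ℝ),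
      expGParam P d R Δ mu lam ≤ expG P d R Δ := fun lam hl mu hmu => by
    obtain ⟨m, v, -, -, hv, -, hle, -, -⟩ := hval hl hmu
    rw [hv, hG, EReal.coe_le_coe_iff]
    refine (hle q₀ hq₀).trans ?_
    have h1 : lam * (mutualInfo q₀ - R) ≤ max 0 (mutualInfo q₀ - R) := by
      refine (mul_le_mul_of_nonneg_left (le_max_right 0 _) hl.1).trans ?_
      exact mul_le_of_le_one_left (le_max_left _ _) hl.2
    have h2 : mu * (expDist d q₀ - Δ) ≤ 0 :=
      mul_nonpos_of_nonneg_of_nonpos hmu (by linarith)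
    linarith
  -- The lower bound holds at every positive block length, not only in the limit: each `G^{(μ,λ)}`
  -- is below the block exponent, and these values approach `G`.
  have hblock : ∀ k : ℕ, 0 < k → expG P d R Δ ≤ blockExponent P d R Δ k := fun k hk => by
    rw [hG]
    refine coe_le_of_forall_sub_le fun ε hε => ?_
    obtain ⟨mu, hmu, h⟩ := hstrong ε hε
    obtain ⟨m, v, -, -, hv, -, -, -, hcode⟩ := hval hls hmu
    exact h.trans (hv ▸ hcode k hk)
  have hinf : ∀ lam ∈ Set.Icc (0 : ℝ) 1, ∀ mu ∈ Set.Ici (0 : ℝ),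
      (⨅ p ∈ stdSimplex ℝ (X × Y),
        (((-lam * R - mu * Δ : ℝ) : EReal) + -elog (normFactor P d mu lam p))) =
      expGParam P d R Δ mu lam := fun lam hl mu hmu => by
    obtain ⟨m, v, -, -, hv, hv', -, -, -⟩ := hval hl hmu
    rw [hv, hv']
  have hgreatest : IsGreatest ((fun lam : ℝ => ⨆ mu ∈ Set.Ici (0 : ℝ), expGParam P d R Δ mu lam) ''
      Set.Icc (0 : ℝ) 1) (expG P d R Δ) := by
    refine ⟨⟨lams, hls, le_antisymm (iSup₂_le fun mu hmu => hweak lams hls mu hmu) ?_⟩, ?_⟩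
    · rw [hG]
      refine coe_le_of_forall_sub_le fun ε hε => ?_
      obtain ⟨mu, hmu, h⟩ := hstrong ε hε
      exact h.trans (le_iSup₂ (f := fun mu (_ : mu ∈ Set.Ici (0 : ℝ)) =>
        expGParam P d R Δ mu lams) mu hmu)
    · rintro _ ⟨lam, hl, rfl⟩
      exact iSup₂_le fun mu hmu => hweak lam hl mu hmu
  refine ⟨fun lam hl mu hmu => ?_, ?_, hgreatest, ?_, fun hΔpos lam hl => ?_⟩
  · obtain ⟨m, v, hvm, hm, hv, -⟩ := hval hl hmu
    exact ⟨m, hm, by rw [hv, hvm, EReal.coe_add]⟩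
  · refine tendsto_order.2 ⟨fun a ha => ?_, fun b hb => ?_⟩
    · filter_upwards [eventually_gt_atTop 0] with k hk
      exact ha.trans_le (hblock k hk)
    · rw [hG] at hb
      obtain ⟨c, hc1, hc2⟩ := EReal.lt_iff_exists_real_btwn.1 hb
      have hc : 0 < c - g := sub_pos.2 (EReal.coe_lt_coe_iff.1 hc1)
      filter_upwards [eventually_blockExponent_le hP hd_nonneg hd_zero hR hΔ hc hq₀ hqΔ] with k hk
      refine lt_of_le_of_lt (hk.trans (le_of_eq ?_)) hc2
      rw [← hg, add_sub_cancel]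
  · have himage : ((fun lam : ℝ => ⨆ mu ∈ Set.Ici (0 : ℝ), ⨅ p ∈ stdSimplex ℝ (X × Y),
        (((-lam * R - mu * Δ : ℝ) : EReal) + -elog (normFactor P d mu lam p))) ''
        Set.Icc (0 : ℝ) 1) = ((fun lam : ℝ => ⨆ mu ∈ Set.Ici (0 : ℝ), expGParam P d R Δ mu lam) ''
        Set.Icc (0 : ℝ) 1) :=
      Set.image_congr fun lam hl => iSup_congr fun mu => iSup_congr fun hmu => hinf lam hl mu hmu
    rw [himage]
    exact hgreatest
  -- The value is chosen as a real function on all of `ℝ`, with a dummy `0` for negative `mu`. It is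
  -- a minimum of affine functions with slopes `expDist d q - Δ`, bounded by compactness and equal
  -- to `-Δ < 0` at a zero-distortion law.
  · have hV : ∀ mu : ℝ, ∃ v : ℝ, 0 ≤ mu → expGParam P d R Δ mu lam = v ∧
        (∀ q ∈ acDist Y P,
          v ≤ lam * (mutualInfo q - R) + divX P q + mu * (expDist d q - Δ)) ∧
        ∃ q ∈ acDist Y P,
          lam * (mutualInfo q - R) + divX P q + mu * (expDist d q - Δ) = v := fun mu => by
      by_cases hmu : 0 ≤ mu
      · obtain ⟨m, v, -, -, hv, -, hle, hex, -⟩ := hval hl hmu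
        exact ⟨v, fun _ => ⟨hv, hle, hex⟩⟩
      · exact ⟨0, fun h => absurd h hmu⟩
    choose V hV using hV
    obtain ⟨L, hL⟩ := (isCompact_acDist (Y := Y) P).exists_bound_of_continuousOn
      (f := fun q => expDist d q - Δ) (by fun_prop)
    obtain ⟨r, hr, hr0⟩ := exists_zero_distortion hP hd_zero
    obtain ⟨mu, hmu, hmax⟩ := exists_max_of_affine_min (fun t ht => (hV t ht).2.1)
      (fun t ht => (hV t ht).2.2) hL ⟨r, hr, by linarith⟩
    have hmax' : IsMaxOn (fun mu' : ℝ => expGParam P d R Δ mu' lam) (Set.Ici 0) mu := by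
      intro s hs
      change expGParam P d R Δ s lam ≤ expGParam P d R Δ mu lam
      rw [(hV s hs).1, (hV mu hmu).1]
      exact EReal.coe_le_coe_iff.2 (hmax s hs)
    refine ⟨mu, hmu, hmax', fun s hs => ?_⟩
    have := hmax' hs
    simp only [Set.mem_ofPred_eq] at this ⊢
    rw [hinf lam hl s hs, hinf lam hl mu hmu]
    exact this
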